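/- Let $G$ be a compact (real, finite-dimensional) Lie group with Lie algebra $\mathfrak g$, let $V$ be a finite-dimensional real vector space and let $\rho:G\to \mathrm{GL}(V)$ be a smooth representation; write $\rho$ also for the infinitesimal representation of $\mathfrak g$. Let $G_\rho=G\times_\rho V$ be the semi-direct product, i.e. the Lie group with underlying manifold $G\times V$ and product $(g,v)(h,w)=(gh,\,v+\rho(g)w)$, and let $\mathfrak g_\rho=\mathfrak g\times V$ be its Lie algebra. Then $V$ admits a $G$-invariant inner product. Fix any $G$-invariant inner product $\langle\cdot,\cdot\rangle$ on $V$. For $w,v\in V$ let $\mu_w(v)\in\mathfrak g^*$ be given by $\mu_w(v)(X)=\langle\rho(X)w,v\rangle$, so that $\mu_w:V\to\mathfrak g^*$ is linear. For $w\in V$ and $\alpha\in\mathfrak g^*$ let $w+\alpha\in\mathfrak g_\rho^*$ be the functional $(X,u)\mapsto \alpha(X)+\langle w,u\rangle$; in this way $V\subset\mathfrak g_\rho^*$. Let $x\in V$. The orbit $\rho(G)x\subset V$ and the coadjoint orbit $\mathcal O=\mathrm{Ad}^*_\rho(G_\rho)\cdot x\subset\mathfrak g_\rho^*$ are embedded submanifolds.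 For every $w\in\rho(G)x$ the affine subspace $w+\mu_w(V)$ is contained in $\mathcal O$, and there is a diffeomorphism $$\phi:\mathcal O\to T^*(\rho(G)x)\quad\text{with}\quad \phi\bigl(w+\mu_w(V)\bigr)=T^*_w(\rho(G)x)\qquad(w\in\rho(G)x),$$ whose restriction to each fiber $w+\mu_w(V)$ is given by a linear isomorphism $\mu_w(V)\to T_w^*(\rho(G)x)$, namely $\phi(w+\mu_w(v))=\langle v,\cdot\rangle|_{T_w(\rho(G)x)}$ for $v\in V$. Moreover, $\phi^*\omega=\Omega$, where $\omega=-d\theta$ is the canonical symplectic form of $T^*(\rho(G)x)$ ($\theta$ the tautological 1-form, so that $\omega=\sum_i dq_i\wedge dp_i$ in cotangent coordinates) and $\Omega$ is the Kostant–Kirillov–Souriau form of $\mathcal O$, given by $\Omega_\xi(\mathrm{ad}^*(X)\xi,\mathrm{ad}^*(Y)\xi)=\xi([X,Y])$ for $\xi\in\mathcal O$ and $X,Y\in\mathfrak g_\rho$, with $\mathrm{ad}^*(X)\xi=-\xi\circ\mathrm{ad}(X)$. -/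

import Mathlib

open scoped Manifold ContDiff

noncomputable section

namespace SemidirectOrbit

/-! ### Coadjoint orbits of a Lie group and the Kostant–Kirillov–Souriau form -/

section Coadjoint

variable {F : Type*} [NormedAddCommGroup F] [NormedSpace ℝ F]
  {H : Type*} [TopologicalSpace H] (J : ModelWithCorners ℝ F H)
  {L : Type*} [TopologicalSpace L] [ChartedSpace H L] [Group L]

/-- The dual `𝔩*` of the Lie algebra `𝔩 = T₁L` of a Lie group `L`. In Mathlib the tangent space
`T₁L` is by definition the model vector space `F`, which provides the norm on `𝔩*`. -/
@[nolint unusedArguments]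
abbrev DualLieAlgebra (_J : ModelWithCorners ℝ F H) (L : Type*) [TopologicalSpace L]
    [ChartedSpace H L] [Group L] : Type _ := F →L[ℝ] ℝ

/-- The adjoint representation: `Ad h` is the differential at `1` of `k ↦ h k h⁻¹`. -/
def Ad (h : L) : GroupLieAlgebra J L →L[ℝ] GroupLieAlgebra J L :=
  mfderiv J J (fun k : L => h * k * h⁻¹) 1

/-- The coadjoint representation: `Ad* h ξ = ξ ∘ Ad h⁻¹`. -/
def coAd (h : L) (ξ : DualLieAlgebra J L) : DualLieAlgebra J L :=
  ContinuousLinearMap.comp (ξ : GroupLieAlgebra J L →L[ℝ] ℝ) (Ad J h⁻¹)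

variable (L) in
/-- The coadjoint orbit of `ξ`. -/
def coadjointOrbit (ξ : DualLieAlgebra J L) : Set (DualLieAlgebra J L) :=
  Set.range fun h : L => coAd J h ξ

variable {J} in
/-- `η = ad*(X) ξ`, that is, `η = -ξ ∘ ad X`. -/
def IsCoad (X : GroupLieAlgebra J L) (ξ η : DualLieAlgebra J L) : Prop :=
  ∀ Z : GroupLieAlgebra J L, η Z = -ξ (⁅X, Z⁆ : GroupLieAlgebra J L)

/-- The inclusion `T_p O → W`: the differential of `O ⊆ W` for a manifold structure on `O`. -/
def tangentIncl {W : Type*} [NormedAddCommGroup W] [NormedSpace ℝ W] (O : Set W)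
    {F' : Type*} [NormedAddCommGroup F'] [NormedSpace ℝ F']
    {H' : Type*} [TopologicalSpace H'] (J' : ModelWithCorners ℝ F' H') [ChartedSpace H' O]
    (p : O) : TangentSpace J' p →L[ℝ] W :=
  mfderiv J' 𝓘(ℝ, W) (Subtype.val : O → W) p

variable (L) in
open Classical in
/-- The Kostant–Kirillov–Souriau form on a coadjoint orbit `O ⊆ 𝔩*`:
`Ω_ξ(ad*(X) ξ, ad*(Y) ξ) = ξ([X, Y])`. (The tangent vectors of a coadjoint orbit at `ξ` are the
`ad*(X) ξ`; the value does not depend on the choice of `X` and `Y`, see `kksForm_eq`.) -/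
def kksForm (O : Set (DualLieAlgebra J L))
    {F' : Type*} [NormedAddCommGroup F'] [NormedSpace ℝ F']
    {H' : Type*} [TopologicalSpace H'] (J' : ModelWithCorners ℝ F' H') [ChartedSpace H' O]
    (ξ : O) (a b : TangentSpace J' ξ) : ℝ :=
  if h : (∃ X : GroupLieAlgebra J L, IsCoad X ξ.1 (tangentIncl O J' ξ a)) ∧
      (∃ Y : GroupLieAlgebra J L, IsCoad Y ξ.1 (tangentIncl O J' ξ b)) then
    ξ.1 (⁅h.1.choose, h.2.choose⁆ : GroupLieAlgebra J L)
  else 0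

variable (L) in
theorem kksForm_eq (O : Set (DualLieAlgebra J L))
    {F' : Type*} [NormedAddCommGroup F'] [NormedSpace ℝ F']
    {H' : Type*} [TopologicalSpace H'] (J' : ModelWithCorners ℝ F' H') [ChartedSpace H' O]
    (ξ : O) (a b : TangentSpace J' ξ) (X Y : GroupLieAlgebra J L)
    (hX : IsCoad X ξ.1 (tangentIncl O J' ξ a)) (hY : IsCoad Y ξ.1 (tangentIncl O J' ξ b)) :
    kksForm J L O J' ξ a b = ξ.1 (⁅X, Y⁆ : GroupLieAlgebra J L) := by
  have h : (∃ X : GroupLieAlgebra J L, IsCoad X ξ.1 (tangentIncl O J' ξ a)) ∧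
      (∃ Y : GroupLieAlgebra J L, IsCoad Y ξ.1 (tangentIncl O J' ξ b)) := ⟨⟨X, hX⟩, ⟨Y, hY⟩⟩
  have skew : ∀ U Z : GroupLieAlgebra J L, ξ.1 (⁅U, Z⁆ : GroupLieAlgebra J L) =
      -ξ.1 (⁅Z, U⁆ : GroupLieAlgebra J L) := by
    intro U Z
    rw [GroupLieAlgebra.bracket_def, VectorField.mlieBracket_swap_apply,
      ← GroupLieAlgebra.bracket_def]
    exact map_neg ξ.1 _
  have e1 := (h.1.choose_spec h.2.choose).symm.trans (hX h.2.choose)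
  have e2 := (h.2.choose_spec X).symm.trans (hY X)
  rw [kksForm, dif_pos h]
  linarith [skew X h.2.choose, skew X Y]

end Coadjoint

/-! ### The cotangent bundle and its canonical symplectic form -/

section Cotangent

variable {E : Type*} [NormedAddCommGroup E] [NormedSpace ℝ E]
  {H : Type*} [TopologicalSpace H] (I : ModelWithCorners ℝ E H)
  (M : Type*) [TopologicalSpace M] [ChartedSpace H M]

/-- The exterior derivative of a 1-form `α` on a manifold without boundary, computed in the
preferred chart at `p`: `dα(a, b) = D_a α̂ (b) - D_b α̂ (a)`, where `α̂` is `α` read in the chart. -/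
def extDerivOneForm [I.Boundaryless] {M : Type*} [TopologicalSpace M] [ChartedSpace H M]
    (α : ∀ p : M, TangentSpace I p →L[ℝ] ℝ) (p : M) (a b : TangentSpace I p) : ℝ :=
  let e := extChartAt I p
  let αhat : E → (E →L[ℝ] ℝ) := fun y => (α (e.symm y)).comp (mfderiv 𝓘(ℝ, E) I e.symm y)
  let a' : E := mfderiv I 𝓘(ℝ, E) e p a
  let b' : E := mfderiv I 𝓘(ℝ, E) e p b
  fderiv ℝ αhat (e p) a' b' - fderiv ℝ αhat (e p) b' a'

variable [IsManifold I 1 M]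

/-- The cotangent bundle `T*M`, as the total space of the bundle dual to the tangent bundle, with
the manifold structure it carries as such. -/
abbrev CotangentBundle : Type _ :=
  Bundle.TotalSpace (E →L[ℝ] ℝ)
    (fun p : M => TangentSpace I p →L[ℝ] Bundle.Trivial M ℝ p)

/-- The model of the cotangent bundle. -/
abbrev cotangentModel : ModelWithCorners ℝ (E × (E →L[ℝ] ℝ)) (ModelProd H (E →L[ℝ] ℝ)) :=
  I.prod 𝓘(ℝ, E →L[ℝ] ℝ)

/-- The tautological 1-form `θ_γ = γ ∘ dπ_γ` on `T*M`, where `π : T*M → M` is the projection. -/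
def tautologicalForm (γ : CotangentBundle I M) :
    TangentSpace (cotangentModel I) γ →L[ℝ] ℝ :=
  ContinuousLinearMap.comp (γ.snd : TangentSpace I γ.proj →L[ℝ] ℝ)
    (mfderiv (cotangentModel I) I (fun γ' : CotangentBundle I M => γ'.proj) γ)

/-- The canonical symplectic form `ω = -dθ` on `T*M`; it is `∑ dqᵢ ∧ dpᵢ` in cotangent
coordinates. -/
def canonicalForm [I.Boundaryless] (γ : CotangentBundle I M)
    (a b : TangentSpace (cotangentModel I) γ) : ℝ :=
  -extDerivOneForm (cotangentModel I) (tautologicalForm I M) γ a b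

end Cotangent

/-! ### Representations and semi-direct products -/

section Semidirect

variable {E : Type*} [NormedAddCommGroup E] [NormedSpace ℝ E]
  {G : Type*} [Group G]
  {V : Type*} [NormedAddCommGroup V] [NormedSpace ℝ V]

/-- The semi-direct product `G ×_ρ V` of a Lie group `G` and the vector group `V`. Its underlying
manifold is the product `G × V`. -/
def SemidirectGroup (_ρ : G →* (V →L[ℝ] V)) : Type _ := G × V

namespace SemidirectGroup

variable (ρ : G →* (V →L[ℝ] V))

/-- `(g, v) (h, w) = (g h, v + ρ(g) w)`. -/
instance : Group (SemidirectGroup ρ) where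
  mul a b := (a.1 * b.1, a.2 + ρ a.1 b.2)
  one := ((1 : G), (0 : V))
  inv a := (a.1⁻¹, -ρ a.1⁻¹ a.2)
  mul_assoc a b c := by
    refine Prod.ext (mul_assoc _ _ _) ?_
    change a.2 + ρ a.1 b.2 + ρ (a.1 * b.1) c.2 = a.2 + ρ a.1 (b.2 + ρ b.1 c.2)
    simp [add_assoc]
  one_mul a := by
    refine Prod.ext (one_mul _) ?_
    change 0 + ρ 1 a.2 = a.2
    simp
  mul_one a := by
    refine Prod.ext (mul_one _) ?_
    change a.2 + ρ a.1 0 = a.2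
    simp
  inv_mul_cancel a := by
    refine Prod.ext (inv_mul_cancel _) ?_
    change -ρ a.1⁻¹ a.2 + ρ a.1⁻¹ a.2 = 0
    simp

variable [TopologicalSpace G] [ChartedSpace E G]

instance : TopologicalSpace (SemidirectGroup ρ) := inferInstanceAs (TopologicalSpace (G × V))

instance : ChartedSpace (ModelProd E V) (SemidirectGroup ρ) :=
  inferInstanceAs (ChartedSpace (ModelProd E V) (G × V))

/-- The component in `G` of an element of `G ×_ρ V`. -/
def toG (a : SemidirectGroup ρ) : G := a.1

/-- The component in `V` of an element of `G ×_ρ V`. -/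
def toV (a : SemidirectGroup ρ) : V := a.2

/-- If the representation is smooth, then `G ×_ρ V` is a Lie group. -/
theorem lieGroup [LieGroup 𝓘(ℝ, E) ∞ G] (hρ : ContMDiff 𝓘(ℝ, E) 𝓘(ℝ, V →L[ℝ] V) ∞ ρ) :
    LieGroup (𝓘(ℝ, E).prod 𝓘(ℝ, V)) ∞ (SemidirectGroup ρ) := by
  have hman : IsManifold (𝓘(ℝ, E).prod 𝓘(ℝ, V)) ∞ (SemidirectGroup ρ) :=
    inferInstanceAs (IsManifold (𝓘(ℝ, E).prod 𝓘(ℝ, V)) ∞ (G × V))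
  have hmul : ContMDiff ((𝓘(ℝ, E).prod 𝓘(ℝ, V)).prod (𝓘(ℝ, E).prod 𝓘(ℝ, V)))
      (𝓘(ℝ, E).prod 𝓘(ℝ, V)) ∞
      (fun p : (G × V) × (G × V) => (p.1.1 * p.2.1, p.1.2 + ρ p.1.1 p.2.2)) := by
    refine (((contMDiff_fst.comp contMDiff_fst).mul (contMDiff_fst.comp contMDiff_snd)).prodMk
      ((contMDiff_snd.comp contMDiff_fst).add ?_))
    exact (hρ.comp (contMDiff_fst.comp contMDiff_fst)).clm_apply
      (contMDiff_snd.comp contMDiff_snd)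
  have hinv : ContMDiff (𝓘(ℝ, E).prod 𝓘(ℝ, V)) (𝓘(ℝ, E).prod 𝓘(ℝ, V)) ∞
      (fun p : G × V => (p.1⁻¹, -ρ p.1⁻¹ p.2)) := by
    refine (contMDiff_fst.inv).prodMk ?_
    exact ((hρ.comp contMDiff_fst.inv).clm_apply contMDiff_snd).neg
  exact { hman with contMDiff_mul := hmul, contMDiff_inv := hinv }

end SemidirectGroup

variable [TopologicalSpace G] [ChartedSpace E G] (ρ : G →* (V →L[ℝ] V))

/-- The model of the semi-direct product `G ×_ρ V`. -/
abbrev semidirectModel (E V : Type*) [NormedAddCommGroup E] [NormedSpace ℝ E]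
    [NormedAddCommGroup V] [NormedSpace ℝ V] : ModelWithCorners ℝ (E × V) (ModelProd E V) :=
  𝓘(ℝ, E).prod 𝓘(ℝ, V)

/-- The projection `𝔤_ρ = 𝔤 × V → 𝔤`. -/
def projG : GroupLieAlgebra (semidirectModel E V) (SemidirectGroup ρ) →L[ℝ]
    GroupLieAlgebra 𝓘(ℝ, E) G :=
  mfderiv (semidirectModel E V) 𝓘(ℝ, E) (SemidirectGroup.toG ρ) 1

/-- The projection `𝔤_ρ = 𝔤 × V → V`. -/
def projV : GroupLieAlgebra (semidirectModel E V) (SemidirectGroup ρ) →L[ℝ] V :=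
  mfderiv (semidirectModel E V) 𝓘(ℝ, V) (SemidirectGroup.toV ρ) 1

/-- `B` is a `G`-invariant inner product on `V`. -/
structure IsInvariantInner (ρ : G →* (V →L[ℝ] V)) (B : V →L[ℝ] V →L[ℝ] ℝ) : Prop where
  symm : ∀ v w, B v w = B w v
  pos : ∀ v, v ≠ 0 → 0 < B v v
  invariant : ∀ g v w, B (ρ g v) (ρ g w) = B v w

/-- The infinitesimal representation: `infRep ρ v X = ρ(X) v = d/dt ρ(exp tX) v` at `t = 0`. -/
def infRep (v : V) : GroupLieAlgebra 𝓘(ℝ, E) G →L[ℝ] V :=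
  mfderiv 𝓘(ℝ, E) 𝓘(ℝ, V) (fun g : G => ρ g v) 1

/-- The moment map `μ_w : V → 𝔤*`, `μ_w(v)(X) = μ(w ⊗ v)(X) = ⟨ρ(X) w, v⟩`. -/
def momentMap (B : V →L[ℝ] V →L[ℝ] ℝ) (w : V) :
    V →ₗ[ℝ] (GroupLieAlgebra 𝓘(ℝ, E) G →L[ℝ] ℝ) where
  toFun v := (B.flip v).comp (infRep ρ w)
  map_add' v v' := by rw [map_add, ContinuousLinearMap.add_comp]
  map_smul' c v := by rw [map_smul, ContinuousLinearMap.smul_comp, RingHom.id_apply]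

/-- The element `w + α` of `𝔤_ρ* = 𝔤* ⊕ V*`, for `α ∈ 𝔤*` and `w ∈ V`, where `V` is identified
with `V*` by the inner product: `(w + α)(X, u) = α(X) + ⟨w, u⟩`. -/
def dualPoint (B : V →L[ℝ] V →L[ℝ] ℝ) (w : V) (α : GroupLieAlgebra 𝓘(ℝ, E) G →L[ℝ] ℝ) :
    DualLieAlgebra (semidirectModel E V) (SemidirectGroup ρ) :=
  (α.comp (projG ρ) + (B w).comp (projV ρ) :
    GroupLieAlgebra (semidirectModel E V) (SemidirectGroup ρ) →L[ℝ] ℝ)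

/-- The orbit `ρ(G) x`. -/
def repOrbit (x : V) : Set V := Set.range fun g : G => ρ g x

variable (E) in
/-- The coadjoint orbit `Ad*_ρ(G_ρ) x` of `x ∈ V ⊆ 𝔤_ρ*`. -/
def semidirectOrbit (B : V →L[ℝ] V →L[ℝ] ℝ) (x : V) :
    Set (DualLieAlgebra (semidirectModel E V) (SemidirectGroup ρ)) :=
  coadjointOrbit (semidirectModel E V) (SemidirectGroup ρ) (dualPoint ρ B x 0)

/-- The affine subspace `w + μ_w(V)` of `𝔤_ρ*`. -/
def orbitFiber (B : V →L[ℝ] V →L[ℝ] ℝ) (w : V) :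
    Set (DualLieAlgebra (semidirectModel E V) (SemidirectGroup ρ)) :=
  dualPoint ρ B w '' (LinearMap.range (momentMap (E := E) ρ B w) : Set _)

end Semidirect

end SemidirectOrbit

end

open scoped Manifold ContDiff Topology

noncomputable section

namespace SemidirectOrbit

/-! ### Subsets of a vector space that are locally graphs -/

section GraphChart

variable {A : Type*} [NormedAddCommGroup A] [NormedSpace ℝ A]
  {W : Type*} [NormedAddCommGroup W] [NormedSpace ℝ W]

/-! Conjugation in `G ×_ρ V` and skewness of `ρ(X)` for the invariant form give `Ad*(g, v) x = w -
μ_w(v)` with `w = ρ(g) x`. Hence the coadjoint orbit is the union of the affine spaces `w + μ_w(V)`,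
`w` in the orbit of `x` (`mem_semidirectOrbit_iff`). Since `μ_w(v)(X) = ⟨ρ(X) w, v⟩` and the vectors
`ρ(X) w` fill the tangent space at `w` (`proj_infAct_surjective`), the functional `μ_w(v)` carries
exactly the information of `⟨v, ·⟩` restricted to that tangent space. The inverse of `φ` is
therefore the map that sends a covector `γ` at `w` to `(X, u) ↦ γ(ρ(X) w) + ⟨w, u⟩`
(`cotangentFunctional`).

Both orbits get their manifold structure from local descriptions as graphs over linear coordinates
(`GraphChart`): the transition maps are then automatically smooth and the inclusion is an embedding.
For the orbit of `x` the graphs come from the rank theorem (`exists_section_of_finrank_le`), the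
orbit map having constant rank by equivariance; compactness of `G` excludes that other parts of the
orbit accumulate at `x`. For the coadjoint orbit they come from cotangent coordinates `(t, q)`
(`fiberPoint`), after a twist of `q` that makes the coordinates restrictions of a linear map on the
ambient dual. Smoothness of `φ` in both directions can be read off in these charts.

For the symplectic forms, `θ` is `p dq` in cotangent coordinates, so `ω((a₁, a₂), (b₁, b₂)) = b₂(a₁)
- a₂(b₁)` (`canonicalForm_eq`). On the other side, a tangent vector `(a₁, a₂)` of the coadjoint
orbit is realized as `ad*(X) ξ` by choosing the `𝔤`-part of `X` to produce `a₁` and then solving for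
its `V`-part through the inner product. Evaluating `ad*(X) ξ` on `Y` makes the terms containing a
second action of `𝔤` cancel and leaves the same expression (`fiberPoint_bracket`). The bracket of
`𝔤_ρ` needed here is read off from the affine representation on `V × ℝ`, whose differential turns
brackets into commutators (`semidirect_bracket`). -/

/-- A presentation of an open piece `S ∩ dom` of `S ⊆ W` as the image of a smooth section `sec`,
defined on an open set of `A`, of a linear map `proj : W → A`. -/
structure GraphChart (A : Type*) [NormedAddCommGroup A] [NormedSpace ℝ A]
    {W : Type*} [NormedAddCommGroup W] [NormedSpace ℝ W] (S : Set W) where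
  /-- The open set on which `S` is a graph. -/
  dom : Set W
  /-- The set of parameters. -/
  param : Set A
  /-- The linear coordinates. -/
  proj : W →L[ℝ] A
  /-- The parametrization. -/
  sec : A → W
  isOpen_dom : IsOpen dom
  isOpen_param : IsOpen param
  contDiffOn_sec : ContDiffOn ℝ ∞ sec param
  sec_mem : ∀ t ∈ param, sec t ∈ S
  sec_mem_dom : ∀ t ∈ param, sec t ∈ dom
  proj_sec : ∀ t ∈ param, proj (sec t) = t
  proj_mem : ∀ s ∈ S, s ∈ dom → proj s ∈ param
  sec_proj : ∀ s ∈ S, s ∈ dom → sec (proj s) = s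

variable {S : Set W}

namespace GraphChart

open Classical in
/-- The chart of `S` attached to a local presentation of `S` as a graph. -/
def toChart (c : GraphChart A S) (s₀ : S) : OpenPartialHomeomorph S A where
  toFun s := c.proj s.1
  -- The value `s₀` outside `param` is a default that only makes the map total.
  invFun t := if ht : t ∈ c.param then ⟨c.sec t, c.sec_mem t ht⟩ else s₀
  source := Subtype.val ⁻¹' c.dom
  target := c.param
  map_source' s hs := c.proj_mem s.1 s.2 hs
  map_target' t ht := by
    simp only [dif_pos ht, Set.mem_preimage]
    exact c.sec_mem_dom t ht
  left_inv' s hs := by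
    simp only [dif_pos (c.proj_mem s.1 s.2 hs)]
    exact Subtype.ext (c.sec_proj s.1 s.2 hs)
  right_inv' t ht := by
    simp only [dif_pos ht]
    exact c.proj_sec t ht
  open_source := c.isOpen_dom.preimage continuous_subtype_val
  open_target := c.isOpen_param
  continuousOn_toFun := (c.proj.continuous.comp continuous_subtype_val).continuousOn
  continuousOn_invFun := by
    rw [Topology.IsEmbedding.subtypeVal.continuousOn_iff]
    refine c.contDiffOn_sec.continuousOn.congr fun t ht => ?_
    simp [dif_pos ht]

@[simp] theorem toChart_apply (c : GraphChart A S) (s₀ s : S) :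
    c.toChart s₀ s = c.proj s.1 := rfl

@[simp] theorem toChart_source (c : GraphChart A S) (s₀ : S) :
    (c.toChart s₀).source = Subtype.val ⁻¹' c.dom := rfl

@[simp] theorem toChart_target (c : GraphChart A S) (s₀ : S) :
    (c.toChart s₀).target = c.param := rfl

theorem toChart_symm_apply (c : GraphChart A S) (s₀ : S) {t : A} (ht : t ∈ c.param) :
    ((c.toChart s₀).symm t).1 = c.sec t := by
  simp [toChart, ht]

theorem hasFDerivAt_sec (c : GraphChart A S) {t : A} (ht : t ∈ c.param) :
    HasFDerivAt c.sec (fderiv ℝ c.sec t) t :=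
  ((c.contDiffOn_sec.contDiffAt (c.isOpen_param.mem_nhds ht)).differentiableAt
    (by simp)).hasFDerivAt

theorem proj_comp_fderiv_sec (c : GraphChart A S) {t : A} (ht : t ∈ c.param) :
    c.proj.comp (fderiv ℝ c.sec t) = ContinuousLinearMap.id ℝ A := by
  have h1 : HasFDerivAt (fun t => c.proj (c.sec t)) (c.proj.comp (fderiv ℝ c.sec t)) t :=
    c.proj.hasFDerivAt.comp t (c.hasFDerivAt_sec ht)
  have h2 : HasFDerivAt (fun t => c.proj (c.sec t)) (ContinuousLinearMap.id ℝ A) t :=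
    (hasFDerivAt_id t).congr_of_eventuallyEq <|
      Filter.eventuallyEq_of_mem (c.isOpen_param.mem_nhds ht) fun y hy => c.proj_sec y hy
  exact h1.unique h2

/-- The diffeomorphism `v ↦ v - sec (proj v) + R (proj v)` of `proj ⁻¹ param`, where `R` is a
linear section of `proj`. It flattens the graph. -/
def shear (c : GraphChart A S) (R : A →L[ℝ] W)
    (hR : c.proj.comp R = ContinuousLinearMap.id ℝ A) : OpenPartialHomeomorph W W :=
  have hR' : ∀ t, c.proj (R t) = t := fun t => DFunLike.congr_fun hR t
  have hcont : ContinuousOn (fun v => c.sec (c.proj v)) (c.proj ⁻¹' c.param) :=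
    c.contDiffOn_sec.continuousOn.comp c.proj.continuous.continuousOn fun _ hv => hv
  { toFun := fun v => v - c.sec (c.proj v) + R (c.proj v)
    invFun := fun v => v - R (c.proj v) + c.sec (c.proj v)
    source := c.proj ⁻¹' c.param
    target := c.proj ⁻¹' c.param
    map_source' := fun v hv => by
      simpa [hR', c.proj_sec _ hv] using hv
    map_target' := fun v hv => by
      simpa [hR', c.proj_sec _ hv] using hv
    left_inv' := fun v hv => by
      simp [hR', c.proj_sec _ hv]
    right_inv' := fun v hv => by
      simp [hR', c.proj_sec _ hv]
    open_source := c.isOpen_param.preimage c.proj.continuous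
    open_target := c.isOpen_param.preimage c.proj.continuous
    continuousOn_toFun :=
      (continuousOn_id.sub hcont).add (R.continuous.comp c.proj.continuous).continuousOn
    continuousOn_invFun :=
      (continuousOn_id.sub (R.continuous.comp c.proj.continuous).continuousOn).add hcont }

theorem shear_mem_maximalAtlas (c : GraphChart A S) (R : A →L[ℝ] W)
    (hR : c.proj.comp R = ContinuousLinearMap.id ℝ A) :
    c.shear R hR ∈ IsManifold.maximalAtlas 𝓘(ℝ, W) ∞ W := by
  have hsec : ContDiffOn ℝ ∞ (fun v => c.sec (c.proj v)) (c.proj ⁻¹' c.param) :=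
    c.contDiffOn_sec.comp c.proj.contDiff.contDiffOn fun _ hv => hv
  have hRP : ContDiffOn ℝ ∞ (fun v => R (c.proj v)) (c.proj ⁻¹' c.param) :=
    (R.contDiff.comp c.proj.contDiff).contDiffOn
  refine OpenPartialHomeomorph.mem_maximalAtlas_of_contMDiffOn _ ?_ ?_
  · rw [contMDiffOn_iff_contDiffOn]
    exact (contDiffOn_id.sub hsec).add hRP
  · rw [contMDiffOn_iff_contDiffOn]
    exact (contDiffOn_id.sub hRP).add hsec

end GraphChart

/-- The manifold structure on a set that is locally a graph. -/
abbrev graphChartedSpace (c : S → GraphChart A S) (hc : ∀ p : S, p.1 ∈ (c p).dom) :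
    ChartedSpace A S where
  atlas := Set.range fun p => (c p).toChart p
  chartAt p := (c p).toChart p
  mem_chart_source p := hc p
  chart_mem_atlas p := ⟨p, rfl⟩

/-- A transition map is a smooth section followed by a linear projection. -/
theorem isManifold_graphChartedSpace (c : S → GraphChart A S) (hc : ∀ p : S, p.1 ∈ (c p).dom) :
    @IsManifold ℝ _ A _ _ A _ 𝓘(ℝ, A) ∞ S _ (graphChartedSpace c hc) := by
  let := graphChartedSpace c hc
  refine isManifold_of_contDiffOn _ _ _ ?_
  rintro _ _ ⟨p, rfl⟩ ⟨q, rfl⟩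
  have h : ContDiffOn ℝ ∞ (fun t => (c q).proj ((c p).sec t)) (c p).param :=
    (c q).proj.contDiff.comp_contDiffOn (c p).contDiffOn_sec
  refine (h.mono ?_).congr ?_
  · intro t ht
    simp only [mfld_simps] at ht
    exact ht.1
  · intro t ht
    simp only [mfld_simps] at ht ⊢
    rw [GraphChart.toChart_apply, GraphChart.toChart_symm_apply _ _ ht.1]

/-- The shear along the graph is a chart of the ambient space in which the inclusion becomes the
linear injection `R = D sec`; the topology on `S` is the induced one. -/
theorem isSmoothEmbedding_graphChartedSpace [FiniteDimensional ℝ A] [FiniteDimensional ℝ W]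
    (c : S → GraphChart A S) (hc : ∀ p : S, p.1 ∈ (c p).dom) :
    @Manifold.IsSmoothEmbedding ℝ _ A W _ _ _ _ A W _ _ 𝓘(ℝ, A) 𝓘(ℝ, W) S W _
      (graphChartedSpace c hc) _ _ ∞ Subtype.val := by
  let := graphChartedSpace c hc
  have := isManifold_graphChartedSpace c hc
  refine ⟨?_, Topology.IsEmbedding.subtypeVal⟩
  -- One complement must serve all points, whereas `ker proj` varies with `p`. A Euclidean space of
  -- the right dimension is identified with each kernel.
  refine Manifold.IsImmersionOfComplement.isImmersion
    (F := EuclideanSpace ℝ (Fin (Module.finrank ℝ W - Module.finrank ℝ A))) fun p => ?_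
  have ht : (c p).proj p.1 ∈ (c p).param := (c p).proj_mem p.1 p.2 (hc p)
  set R : A →L[ℝ] W := fderiv ℝ (c p).sec ((c p).proj p.1)
  have hR : (c p).proj.comp R = ContinuousLinearMap.id ℝ A := (c p).proj_comp_fderiv_sec ht
  have hR' : ∀ t, (c p).proj (R t) = t := fun t => DFunLike.congr_fun hR t
  have hsurj : LinearMap.range ((c p).proj : W →ₗ[ℝ] A) = ⊤ :=
    LinearMap.range_eq_top.2 fun t => ⟨R t, hR' t⟩
  have hfr : Module.finrank ℝ (EuclideanSpace ℝ (Fin (Module.finrank ℝ W - Module.finrank ℝ A))) =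
      Module.finrank ℝ (LinearMap.ker ((c p).proj : W →ₗ[ℝ] A)) := by
    have h := LinearMap.finrank_range_add_finrank_ker ((c p).proj : W →ₗ[ℝ] A)
    rw [hsurj, finrank_top] at h
    simp only [finrank_euclideanSpace, Fintype.card_fin]
    omega
  let K := ContinuousLinearEquiv.ofFinrankEq (𝕜 := ℝ) hfr
  -- The splitting of `W` as the range of `R` plus the kernel of `proj`.
  let eqv : (A × EuclideanSpace ℝ (Fin (Module.finrank ℝ W - Module.finrank ℝ A))) ≃L[ℝ] W :=
    LinearEquiv.toContinuousLinearEquiv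
      { toFun := fun x => R x.1 + (K x.2 : W)
        map_add' := fun x y => by
          simp only [Prod.fst_add, Prod.snd_add, map_add, Submodule.coe_add]
          abel
        map_smul' := fun r x => by simp
        invFun := fun w => ((c p).proj w, K.symm ⟨w - R ((c p).proj w), by simp [hR']⟩)
        left_inv := fun x => by
          have h0 : (c p).proj (K x.2 : W) = 0 := (K x.2).2
          refine Prod.ext (by simp [hR', h0]) ?_
          simp [hR', h0]
        right_inv := fun w => by simp }
  refine Manifold.IsImmersionAtOfComplement.mk_of_continuousAt
    continuous_subtype_val.continuousAt eqv ((c p).toChart p) ((c p).shear R hR) (hc p) ht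
    (IsManifold.chart_mem_maximalAtlas p) ((c p).shear_mem_maximalAtlas R hR) ?_
  intro t ht
  simp only [mfld_simps] at ht
  simp only [mfld_simps]
  rw [GraphChart.toChart_symm_apply _ _ ht]
  change (c p).sec t - (c p).sec ((c p).proj ((c p).sec t)) + R ((c p).proj ((c p).sec t)) =
    R t + (K 0 : W)
  rw [(c p).proj_sec t ht]
  simp

section Tangent

variable [ChartedSpace A S] [IsManifold 𝓘(ℝ, A) ∞ S] (c : S → GraphChart A S)
  (hchart : ∀ p : S, chartAt A p = (c p).toChart p)

include hchart

omit [IsManifold 𝓘(ℝ, A) ∞ S] in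
theorem extChartAt_graph_apply (p s : S) : extChartAt 𝓘(ℝ, A) p s = (c p).proj s.1 := by
  simp [hchart, mfld_simps]

omit [IsManifold 𝓘(ℝ, A) ∞ S] in
theorem extChartAt_graph_target (p : S) : (extChartAt 𝓘(ℝ, A) p).target = (c p).param := by
  simp [hchart, mfld_simps]

variable (hval : ContMDiff 𝓘(ℝ, A) 𝓘(ℝ, W) ∞ (Subtype.val : S → W))
include hval

-- The chart is the restriction of a linear map, so its differential is that map on tangent vectors
-- viewed in `W`.
omit [IsManifold 𝓘(ℝ, A) ∞ S] in
theorem mfderiv_extChartAt_graph (p s : S) (a : TangentSpace 𝓘(ℝ, A) s) :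
    (mfderiv 𝓘(ℝ, A) 𝓘(ℝ, A) (extChartAt 𝓘(ℝ, A) p) s a : A) =
      (c p).proj (tangentIncl S 𝓘(ℝ, A) s a) := by
  have h1 : (extChartAt 𝓘(ℝ, A) p : S → A) = (c p).proj ∘ Subtype.val :=
    funext fun s => extChartAt_graph_apply c hchart p s
  have h2 : HasMFDerivAt 𝓘(ℝ, A) 𝓘(ℝ, W) (Subtype.val : S → W) s (tangentIncl S 𝓘(ℝ, A) s) :=
    ((hval s).mdifferentiableAt (by simp)).hasMFDerivAt
  have h3 : HasMFDerivAt 𝓘(ℝ, W) 𝓘(ℝ, A) (c p).proj s.1 (c p).proj :=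
    (c p).proj.hasMFDerivAt
  have h4 := (h3.comp s h2).mfderiv
  rw [h1, h4]
  rfl

theorem proj_tangentIncl (s : S) (a : TangentSpace 𝓘(ℝ, A) s) :
    (c s).proj (tangentIncl S 𝓘(ℝ, A) s a) = a := by
  rw [← mfderiv_extChartAt_graph c hchart hval s s a, mfderiv_extChartAt_self]
  rfl

/-- Differentiate the identity `val = sec ∘ chart`, valid near `s`. The chart may be centred at a
point other than `s`. -/
theorem tangentIncl_eq (p s : S) (hs : s.1 ∈ (c p).dom) (a : TangentSpace 𝓘(ℝ, A) s) :
    tangentIncl S 𝓘(ℝ, A) s a =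
      fderiv ℝ (c p).sec ((c p).proj s.1) ((c p).proj (tangentIncl S 𝓘(ℝ, A) s a)) := by
  have h1 : (Subtype.val : S → W) =ᶠ[𝓝 s] (c p).sec ∘ extChartAt 𝓘(ℝ, A) p := by
    refine Filter.eventuallyEq_of_mem
      (((c p).isOpen_dom.preimage continuous_subtype_val).mem_nhds hs) fun y hy => ?_
    simp only [Function.comp_apply, extChartAt_graph_apply c hchart]
    exact ((c p).sec_proj y.1 y.2 hy).symm
  have hs' : s ∈ (chartAt A p).source := by
    rw [hchart]; exact hs
  have h2 : HasMFDerivAt 𝓘(ℝ, A) 𝓘(ℝ, A) (extChartAt 𝓘(ℝ, A) p) s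
      (mfderiv 𝓘(ℝ, A) 𝓘(ℝ, A) (extChartAt 𝓘(ℝ, A) p) s) :=
    (mdifferentiableAt_extChartAt hs').hasMFDerivAt
  have h3 : HasMFDerivAt 𝓘(ℝ, A) 𝓘(ℝ, W) (c p).sec (extChartAt 𝓘(ℝ, A) p s)
      (fderiv ℝ (c p).sec ((c p).proj s.1)) := by
    rw [extChartAt_graph_apply c hchart]
    exact ((c p).hasFDerivAt_sec ((c p).proj_mem s.1 s.2 hs)).hasMFDerivAt
  have h4 := ((h3.comp s h2).congr_of_eventuallyEq h1).mfderiv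
  rw [← mfderiv_extChartAt_graph c hchart hval p s a]
  unfold tangentIncl
  rw [h4]
  rfl

end Tangent

end GraphChart

/-! ### The image of a map of constant rank -/

section ConstantRank

variable {E : Type*} [NormedAddCommGroup E] [NormedSpace ℝ E] [FiniteDimensional ℝ E]
  {V : Type*} [NormedAddCommGroup V] [NormedSpace ℝ V] [FiniteDimensional ℝ V]
  {A : Type*} [NormedAddCommGroup A] [NormedSpace ℝ A] [FiniteDimensional ℝ A]

/-- If `P ∘ L` is onto and the rank of `L` is at most the dimension of the target of `P`, then
`P` is injective on the range of `L`. -/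
theorem eq_zero_of_comp_eq_zero_of_finrank_range_le {E' : Type*} [NormedAddCommGroup E']
    [NormedSpace ℝ E'] (L : E' →L[ℝ] V) (P : V →L[ℝ] A)
    (hsurj : Function.Surjective (P.comp L))
    (hrank : Module.finrank ℝ (LinearMap.range (L : E' →ₗ[ℝ] V)) ≤ Module.finrank ℝ A)
    {v : E'} (hv : P (L v) = 0) : L v = 0 := by
  let Q : LinearMap.range (L : E' →ₗ[ℝ] V) →ₗ[ℝ] A :=
    (P : V →ₗ[ℝ] A) ∘ₗ (LinearMap.range (L : E' →ₗ[ℝ] V)).subtype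
  have hQ : Function.Surjective Q := fun a => by
    obtain ⟨y, hy⟩ := hsurj a
    exact ⟨⟨L y, y, rfl⟩, hy⟩
  have heq : Module.finrank ℝ (LinearMap.range (L : E' →ₗ[ℝ] V)) = Module.finrank ℝ A :=
    le_antisymm hrank (LinearMap.finrank_le_finrank_of_surjective hQ)
  have hinj : Function.Injective Q :=
    (LinearMap.injective_iff_surjective_of_finrank_eq_finrank heq).2 hQ
  have h0 : (⟨L v, v, rfl⟩ : LinearMap.range (L : E' →ₗ[ℝ] V)) = 0 := by
    refine hinj ?_
    rw [map_zero]
    exact hv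
  exact congrArg Subtype.val h0

/-- The rank theorem: near a point, the image of a map of locally constant rank is the image of a
smooth section of a linear map. -/
theorem exists_section_of_finrank_le {f : E → V} {Ω : Set E} (hΩ : IsOpen Ω)
    (hf : ContDiffOn ℝ ∞ f Ω) {y₀ : E} (hy₀ : y₀ ∈ Ω)
    (hrank₀ : Module.finrank ℝ (LinearMap.range (fderiv ℝ f y₀ : E →ₗ[ℝ] V)) =
      Module.finrank ℝ A)
    (hrank : ∀ y ∈ Ω, Module.finrank ℝ (LinearMap.range (fderiv ℝ f y : E →ₗ[ℝ] V)) ≤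
      Module.finrank ℝ A) :
    ∃ (N : Set E) (D : Set A) (P : V →L[ℝ] A) (h : A → V), IsOpen N ∧ y₀ ∈ N ∧ N ⊆ Ω ∧ IsOpen D ∧
      ContDiffOn ℝ ∞ h D ∧ f '' N = h '' D ∧ ∀ t ∈ D, P (h t) = t := by
  set L := fderiv ℝ f y₀ with hL
  set T := LinearMap.range (L : E →ₗ[ℝ] V) with hT
  set K := LinearMap.ker (L : E →ₗ[ℝ] V) with hK
  -- `P` extends an isomorphism from the range of `L` to `A`, and `Q` is a linear retraction onto
  -- the kernel of `L`. The differential of `y ↦ (P (f y), Q y)` at `y₀` is then invertible, and the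
  -- inverse function theorem makes this map a local coordinate system.
  obtain ⟨P', hP'⟩ := LinearMap.exists_extend (LinearEquiv.ofFinrankEq T A hrank₀).toLinearMap
  obtain ⟨Q', hQ'⟩ := LinearMap.exists_extend (LinearMap.id : K →ₗ[ℝ] K)
  let P : V →L[ℝ] A := LinearMap.toContinuousLinearMap P'
  let Q : E →L[ℝ] K := LinearMap.toContinuousLinearMap Q'
  have hPT : ∀ v : E, P (L v) = 0 → L v = 0 := by
    intro v hv
    have h1 : (LinearEquiv.ofFinrankEq T A hrank₀) ⟨L v, v, rfl⟩ = 0 := by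
      have := LinearMap.congr_fun hP' ⟨L v, v, rfl⟩
      exact this.symm.trans hv
    have h2 := (LinearEquiv.map_eq_zero_iff _).1 h1
    exact congrArg Subtype.val h2
  have hQK : ∀ v : K, Q v = v := fun v => LinearMap.congr_fun hQ' v
  let Θ : E → A × K := fun y => (P (f y), Q y)
  have hΘ : ContDiffOn ℝ ∞ Θ Ω := (P.contDiff.comp_contDiffOn hf).prodMk Q.contDiff.contDiffOn
  have hfd : ∀ y ∈ Ω, HasFDerivAt f (fderiv ℝ f y) y := fun y hy =>
    ((hf.contDiffAt (hΩ.mem_nhds hy)).differentiableAt (by simp)).hasFDerivAt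
  have hΘd : ∀ y ∈ Ω, HasFDerivAt Θ ((P.comp (fderiv ℝ f y)).prod Q) y := fun y hy =>
    (P.hasFDerivAt.comp y (hfd y hy)).prodMk Q.hasFDerivAt
  have hinj : Function.Injective ((P.comp L).prod Q) := by
    rw [injective_iff_map_eq_zero]
    intro v hv
    have h1 : P (L v) = 0 := congrArg Prod.fst hv
    have h2 : Q v = 0 := congrArg Prod.snd hv
    have h3 : v ∈ K := hPT v h1
    have h4 := hQK ⟨v, h3⟩
    rw [show Q ((⟨v, h3⟩ : K) : E) = 0 from h2] at h4
    exact (congrArg Subtype.val h4).symm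
  have hfr : Module.finrank ℝ E = Module.finrank ℝ (A × K) := by
    rw [Module.finrank_prod, ← hrank₀]
    exact (LinearMap.finrank_range_add_finrank_ker (L : E →ₗ[ℝ] V)).symm
  let Λ : E ≃L[ℝ] A × K := (LinearEquiv.ofInjectiveOfFinrankEq
    (((P.comp L).prod Q : E →L[ℝ] A × K) : E →ₗ[ℝ] A × K) hinj hfr).toContinuousLinearEquiv
  have hΛ : (Λ : E →L[ℝ] A × K) = (P.comp L).prod Q := by ext v <;> rfl
  have hstrict : HasStrictFDerivAt Θ (Λ : E →L[ℝ] A × K) y₀ := by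
    have h := (hΘ.contDiffAt (hΩ.mem_nhds hy₀)).hasStrictFDerivAt (by simp)
    rwa [(hΘd y₀ hy₀).fderiv, ← hΛ] at h
  let Φ := hstrict.toOpenPartialHomeomorph Θ
  -- Invertibility of the differential is an open condition; restricting to it makes the inverse
  -- coordinates smooth on a whole neighbourhood and not only at the centre.
  let R₀ : Set E := Ω ∩ fderiv ℝ Θ ⁻¹' Set.range ContinuousLinearEquiv.toContinuousLinearMap
  have hR : IsOpen R₀ :=
    (hΘ.continuousOn_fderiv_of_isOpen hΩ (by simp)).isOpen_inter_preimage hΩ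
      ContinuousLinearEquiv.isOpen
  have hyR : y₀ ∈ R₀ := ⟨hy₀, Λ, by rw [(hΘd y₀ hy₀).fderiv, hΛ]⟩
  have hyΦ : y₀ ∈ Φ.source := hstrict.mem_toOpenPartialHomeomorph_source
  have hO : Φ.target ∩ Φ.symm ⁻¹' R₀ ∈ 𝓝 (Φ y₀) :=
    (Φ.isOpen_inter_preimage_symm hR).mem_nhds
      ⟨Φ.map_source hyΦ, by rw [Set.mem_preimage, Φ.left_inv hyΦ]; exact hyR⟩
  obtain ⟨r, hr, hball⟩ := Metric.mem_nhds_iff.1 hO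
  have hbox : ∀ t k, t ∈ Metric.ball (Φ y₀).1 r → k ∈ Metric.ball (Φ y₀).2 r →
      (t, k) ∈ Metric.ball (Φ y₀) r := fun t k ht hk => by
    have h := ball_prod_same (Φ y₀).1 (Φ y₀).2 r
    exact h ▸ Set.mk_mem_prod ht hk
  let g : A × K → V := fun z => f (Φ.symm z)
  have hsymm : ∀ z ∈ Metric.ball (Φ y₀) r, ContDiffAt ℝ ∞ Φ.symm z := fun z hz => by
    obtain ⟨Λz, hΛz⟩ := (hball hz).2.2
    refine Φ.contDiffAt_symm (f₀' := Λz) (hball hz).1 ?_ ?_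
    · rw [hΛz]
      exact (hΘd _ (hball hz).2.1).differentiableAt.hasFDerivAt
    · exact hΘ.contDiffAt (hΩ.mem_nhds (hball hz).2.1)
  have hg : ∀ z ∈ Metric.ball (Φ y₀) r, ContDiffAt ℝ ∞ g z := fun z hz =>
    (hf.contDiffAt (hΩ.mem_nhds (hball hz).2.1)).comp z (hsymm z hz)
  have hPg : ∀ z ∈ Metric.ball (Φ y₀) r, P (g z) = z.1 := fun z hz =>
    congrArg Prod.fst (Φ.right_inv (hball hz).1)
  have hgd : ∀ z ∈ Metric.ball (Φ y₀) r, HasFDerivAt g (fderiv ℝ g z) z := fun z hz =>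
    ((hg z hz).differentiableAt (by simp)).hasFDerivAt
  have hPgd : ∀ z ∈ Metric.ball (Φ y₀) r,
      P.comp (fderiv ℝ g z) = ContinuousLinearMap.fst ℝ A K := fun z hz => by
    have h1 : HasFDerivAt (fun z => P (g z)) (P.comp (fderiv ℝ g z)) z :=
      P.hasFDerivAt.comp z (hgd z hz)
    have h2 : HasFDerivAt (fun z => P (g z)) (ContinuousLinearMap.fst ℝ A K) z :=
      hasFDerivAt_fst.congr_of_eventuallyEq
        (Filter.eventuallyEq_of_mem (Metric.isOpen_ball.mem_nhds hz) hPg)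
    exact h1.unique h2
  have hgrank : ∀ z ∈ Metric.ball (Φ y₀) r,
      Module.finrank ℝ (LinearMap.range (fderiv ℝ g z : A × K →ₗ[ℝ] V)) ≤
        Module.finrank ℝ A := fun z hz => by
    have h1 : fderiv ℝ g z = (fderiv ℝ f (Φ.symm z)).comp (fderiv ℝ Φ.symm z) :=
      ((hfd _ (hball hz).2.1).comp z
        ((hsymm z hz).differentiableAt (by simp)).hasFDerivAt).fderiv
    refine le_trans ?_ (hrank _ (hball hz).2.1)
    rw [h1]
    exact Submodule.finrank_mono (LinearMap.range_comp_le_range _ _)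
  -- In these coordinates `P ∘ g` is the first projection, so `P` kills the derivatives of `g` along
  -- `K`. The rank bound makes `P` injective on the range of the differential, so these derivatives
  -- vanish and `g` depends on `t` alone.
  have hgk : ∀ z ∈ Metric.ball (Φ y₀) r, ∀ κ : K, fderiv ℝ g z (0, κ) = 0 := fun z hz κ => by
    refine eq_zero_of_comp_eq_zero_of_finrank_range_le _ P ?_ (hgrank z hz) ?_
    · rw [hPgd z hz]
      exact Prod.fst_surjective
    · exact DFunLike.congr_fun (hPgd z hz) (0, κ)
  have hconst : ∀ t ∈ Metric.ball (Φ y₀).1 r, ∀ k ∈ Metric.ball (Φ y₀).2 r,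
      g (t, k) = g (t, (Φ y₀).2) := fun t ht k hk => by
    have hd : ∀ k ∈ Metric.ball (Φ y₀).2 r, HasFDerivAt (fun k => g (t, k))
        ((fderiv ℝ g (t, k)).comp (ContinuousLinearMap.inr ℝ A K)) k := fun k hk =>
      (hgd _ (hbox t k ht hk)).comp k (hasFDerivAt_prodMk_right t k)
    refine Metric.isOpen_ball.is_const_of_fderiv_eq_zero (𝕜 := ℝ) (f := fun k => g (t, k))
      (convex_ball _ _).isPreconnected
      (fun k hk => (hd k hk).differentiableAt.differentiableWithinAt) (fun k hk => ?_) hk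
      (Metric.mem_ball_self hr)
    rw [(hd k hk).fderiv]
    ext κ
    exact hgk _ (hbox t k ht hk) κ
  refine ⟨Φ.source ∩ Φ ⁻¹' Metric.ball (Φ y₀) r, Metric.ball (Φ y₀).1 r, P,
    fun t => g (t, (Φ y₀).2), Φ.isOpen_inter_preimage Metric.isOpen_ball,
    ⟨hyΦ, Metric.mem_ball_self hr⟩, ?_, Metric.isOpen_ball, ?_, ?_, ?_⟩
  · rintro y ⟨hy, hy'⟩
    have h := (hball hy').2.1
    rwa [Φ.left_inv hy] at h
  · intro t ht
    exact ((hg _ (hbox t _ ht (Metric.mem_ball_self hr))).comp t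
      (contDiffAt_id.prodMk contDiffAt_const)).contDiffWithinAt
  · ext v
    constructor
    · rintro ⟨y, ⟨hy, hy'⟩, rfl⟩
      have hy2 : Φ y ∈ Metric.ball (Φ y₀).1 r ×ˢ Metric.ball (Φ y₀).2 r := by
        rw [ball_prod_same]; exact hy'
      refine ⟨(Φ y).1, hy2.1, ?_⟩
      change g ((Φ y).1, (Φ y₀).2) = f y
      rw [← hconst _ hy2.1 _ hy2.2]
      change f (Φ.symm (Φ y)) = f y
      rw [Φ.left_inv hy]
    · rintro ⟨t, ht, rfl⟩
      have hz := hbox t _ ht (Metric.mem_ball_self hr)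
      refine ⟨Φ.symm (t, (Φ y₀).2), ⟨Φ.map_target (hball hz).1, ?_⟩, rfl⟩
      rw [Set.mem_preimage, Φ.right_inv (hball hz).1]
      exact hz
  · intro t ht
    exact hPg _ (hbox t _ ht (Metric.mem_ball_self hr))

end ConstantRank

/-! ### Orbits of a compact group are locally graphs -/

namespace GraphChart

variable {A : Type*} [NormedAddCommGroup A] [NormedSpace ℝ A]
  {W : Type*} [NormedAddCommGroup W] [NormedSpace ℝ W] {S : Set W}

/-- The image of a graph chart under a linear automorphism that preserves the set. -/
def map (c : GraphChart A S) (T : W ≃L[ℝ] W) (hT : ∀ s, T s ∈ S ↔ s ∈ S) : GraphChart A S where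
  dom := T.symm ⁻¹' c.dom
  param := c.param
  proj := c.proj.comp (T.symm : W →L[ℝ] W)
  sec t := T (c.sec t)
  isOpen_dom := c.isOpen_dom.preimage T.symm.continuous
  isOpen_param := c.isOpen_param
  contDiffOn_sec := T.contDiff.comp_contDiffOn c.contDiffOn_sec
  sec_mem t ht := (hT _).2 (c.sec_mem t ht)
  sec_mem_dom t ht := by simpa using c.sec_mem_dom t ht
  proj_sec t ht := by simpa using c.proj_sec t ht
  proj_mem s hs hs' := c.proj_mem _ ((hT _).1 (by simpa using hs)) hs'
  sec_proj s hs hs' := by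
    have h := c.sec_proj _ ((hT (T.symm s)).1 (by simpa using hs)) hs'
    simp [h]

end GraphChart

section Orbit

variable {E : Type*} [NormedAddCommGroup E] [NormedSpace ℝ E]
  {G : Type*} [Group G] [TopologicalSpace G] [ChartedSpace E G] [LieGroup 𝓘(ℝ, E) ∞ G]
  {V : Type*} [NormedAddCommGroup V] [NormedSpace ℝ V]
  {ρ : G →* (V →L[ℝ] V)}

/-- A representation as a homomorphism to the linear automorphisms. -/
def repEquiv (ρ : G →* (V →L[ℝ] V)) (g : G) : V ≃L[ℝ] V :=
  ContinuousLinearEquiv.equivOfInverse (ρ g) (ρ g⁻¹)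
    (fun v => by
      rw [← mul_apply_eq_comp, ← map_mul, inv_mul_cancel, map_one]; rfl)
    (fun v => by
      rw [← mul_apply_eq_comp, ← map_mul, mul_inv_cancel, map_one]; rfl)

omit [TopologicalSpace G] in
theorem rep_mul_apply (ρ : G →* (V →L[ℝ] V)) (g h : G) (v : V) : ρ (g * h) v = ρ g (ρ h v) := by
  rw [map_mul]; rfl

omit [TopologicalSpace G] in
theorem rep_inv_apply (ρ : G →* (V →L[ℝ] V)) (g : G) (v : V) : ρ g⁻¹ (ρ g v) = v :=
  (repEquiv ρ g).symm_apply_apply v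

omit [TopologicalSpace G] in
theorem rep_apply_inv (ρ : G →* (V →L[ℝ] V)) (g : G) (v : V) : ρ g (ρ g⁻¹ v) = v :=
  (repEquiv ρ g).apply_symm_apply v

omit [TopologicalSpace G] in
theorem rep_mem_repOrbit_iff (ρ : G →* (V →L[ℝ] V)) (x : V) (g : G) (v : V) :
    ρ g v ∈ repOrbit ρ x ↔ v ∈ repOrbit ρ x := by
  constructor
  · rintro ⟨h, hh⟩
    refine ⟨g⁻¹ * h, ?_⟩
    simp only at hh ⊢
    rw [rep_mul_apply, hh, rep_inv_apply]
  · rintro ⟨h, rfl⟩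
    exact ⟨g * h, rep_mul_apply ρ g h x⟩

omit [LieGroup 𝓘(ℝ, E) ∞ G] in
theorem contMDiff_rep_apply (hρ : ContMDiff 𝓘(ℝ, E) 𝓘(ℝ, V →L[ℝ] V) ∞ ρ) (v : V) :
    ContMDiff 𝓘(ℝ, E) 𝓘(ℝ, V) ∞ (fun g : G => ρ g v) :=
  hρ.clm_apply contMDiff_const

variable (E) in
/-- The differential at `1` of a representation. -/
def dRep (ρ : G →* (V →L[ℝ] V)) : E →L[ℝ] V →L[ℝ] V :=
  mfderiv 𝓘(ℝ, E) 𝓘(ℝ, V →L[ℝ] V) ρ 1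

variable (E) in
/-- The infinitesimal action `v ↦ (X ↦ ρ(X) v)`, with the Lie algebra identified with the model
space. -/
def infAct (ρ : G →* (V →L[ℝ] V)) : V →L[ℝ] E →L[ℝ] V := (dRep E ρ).flip

omit [LieGroup 𝓘(ℝ, E) ∞ G] in
theorem hasMFDerivAt_rep_apply (hρ : ContMDiff 𝓘(ℝ, E) 𝓘(ℝ, V →L[ℝ] V) ∞ ρ) (v : V) :
    HasMFDerivAt 𝓘(ℝ, E) 𝓘(ℝ, V) (fun g : G => ρ g v) 1 (infAct E ρ v) := by
  have h1 : HasMFDerivAt 𝓘(ℝ, E) 𝓘(ℝ, V →L[ℝ] V) ρ 1 (dRep E ρ) :=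
    ((hρ 1).mdifferentiableAt (by simp)).hasMFDerivAt
  have h2 : HasMFDerivAt 𝓘(ℝ, V →L[ℝ] V) 𝓘(ℝ, V)
      (ContinuousLinearMap.apply ℝ V v) (ρ 1) (ContinuousLinearMap.apply ℝ V v) :=
    (ContinuousLinearMap.apply ℝ V v).hasMFDerivAt
  exact h2.comp (1 : G) h1

omit [LieGroup 𝓘(ℝ, E) ∞ G] in
theorem infRep_eq (hρ : ContMDiff 𝓘(ℝ, E) 𝓘(ℝ, V →L[ℝ] V) ∞ ρ) (v : V) :
    infRep ρ v = infAct E ρ v :=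
  (hasMFDerivAt_rep_apply hρ v).mfderiv

/-- The differential of the orbit map at any point factors through the one at `1`. -/
theorem hasMFDerivAt_rep_apply_left (hρ : ContMDiff 𝓘(ℝ, E) 𝓘(ℝ, V →L[ℝ] V) ∞ ρ) (v : V) (g : G) :
    ∃ (T : E →L[ℝ] E) (D : E →L[ℝ] V), D = (ρ g).comp ((infAct E ρ v).comp T) ∧
      HasMFDerivAt 𝓘(ℝ, E) 𝓘(ℝ, V) (fun g : G => ρ g v) g D := by
  -- This differentiates `ρ(k) v = ρ(g) ρ(g⁻¹ k) v` in `k`.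
  refine ⟨mfderiv 𝓘(ℝ, E) 𝓘(ℝ, E) (fun k : G => g⁻¹ * k) g, _, rfl, ?_⟩
  have h1 : HasMFDerivAt 𝓘(ℝ, E) 𝓘(ℝ, E) (fun k : G => g⁻¹ * k) g
      (mfderiv 𝓘(ℝ, E) 𝓘(ℝ, E) (fun k : G => g⁻¹ * k) g) :=
    ((contMDiff_mul_left (I := 𝓘(ℝ, E)) (n := ∞) (a := g⁻¹) g).mdifferentiableAt
      (by simp)).hasMFDerivAt
  have h2 : HasMFDerivAt 𝓘(ℝ, E) 𝓘(ℝ, V) (fun g : G => ρ g v) (g⁻¹ * g) (infAct E ρ v) := by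
    rw [inv_mul_cancel]
    exact hasMFDerivAt_rep_apply hρ v
  have h3 : HasMFDerivAt 𝓘(ℝ, V) 𝓘(ℝ, V) (ρ g) (ρ (g⁻¹ * g) v) (ρ g) :=
    (ρ g).hasMFDerivAt
  have h4 := h3.comp g (h2.comp g h1)
  have h5 : (ρ g ∘ (fun g : G => ρ g v) ∘ fun k : G => g⁻¹ * k) = fun g : G => ρ g v := by
    funext k
    simp only [Function.comp_apply]
    rw [← rep_mul_apply, mul_inv_cancel_left]
  rw [h5] at h4
  exact h4

/-- Conjugation: `ρ(X) ρ(g) v = ρ(g) ρ(Ad(g⁻¹) X) v`. -/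
theorem infAct_rep (hρ : ContMDiff 𝓘(ℝ, E) 𝓘(ℝ, V →L[ℝ] V) ∞ ρ) (v : V) (g : G) :
    ∃ T : E →L[ℝ] E, infAct E ρ (ρ g v) = (ρ g).comp ((infAct E ρ v).comp T) := by
  refine ⟨mfderiv 𝓘(ℝ, E) 𝓘(ℝ, E) (fun k : G => g⁻¹ * k * g) 1, ?_⟩
  have hc : ContMDiff 𝓘(ℝ, E) 𝓘(ℝ, E) ∞ (fun k : G => g⁻¹ * k * g) :=
    contMDiff_mul_right.comp contMDiff_mul_left
  have h1 : HasMFDerivAt 𝓘(ℝ, E) 𝓘(ℝ, E) (fun k : G => g⁻¹ * k * g) 1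
      (mfderiv 𝓘(ℝ, E) 𝓘(ℝ, E) (fun k : G => g⁻¹ * k * g) 1) :=
    ((hc 1).mdifferentiableAt (by simp)).hasMFDerivAt
  have h2 : HasMFDerivAt 𝓘(ℝ, E) 𝓘(ℝ, V) (fun g : G => ρ g v) (g⁻¹ * 1 * g)
      (infAct E ρ v) := by
    rw [mul_one, inv_mul_cancel]
    exact hasMFDerivAt_rep_apply hρ v
  have h3 : HasMFDerivAt 𝓘(ℝ, V) 𝓘(ℝ, V) (ρ g) (ρ (g⁻¹ * 1 * g) v) (ρ g) :=
    (ρ g).hasMFDerivAt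
  have h4 := h3.comp (1 : G) (h2.comp (1 : G) h1)
  have h5 : (ρ g ∘ (fun g : G => ρ g v) ∘ fun k : G => g⁻¹ * k * g) =
      fun k : G => ρ k (ρ g v) := by
    funext k
    simp only [Function.comp_apply]
    rw [← rep_mul_apply, ← rep_mul_apply]
    congr 2
    group
  rw [h5] at h4
  exact (hasMFDerivAt_rep_apply hρ (ρ g v)).mfderiv.symm.trans h4.mfderiv

variable [FiniteDimensional ℝ V]

theorem finrank_range_comp_comp_le {E₁ E₂ : Type*} [NormedAddCommGroup E₁] [NormedSpace ℝ E₁]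
    [NormedAddCommGroup E₂] [NormedSpace ℝ E₂]
    (R : V →L[ℝ] V) (L : E₁ →L[ℝ] V) (T : E₂ →L[ℝ] E₁) :
    Module.finrank ℝ (LinearMap.range (R.comp (L.comp T) : E₂ →ₗ[ℝ] V)) ≤
      Module.finrank ℝ (LinearMap.range (L : E₁ →ₗ[ℝ] V)) := by
  have h : LinearMap.range (R.comp (L.comp T) : E₂ →ₗ[ℝ] V) ≤
      (LinearMap.range (L : E₁ →ₗ[ℝ] V)).map (R : V →ₗ[ℝ] V) := by
    rintro _ ⟨y, rfl⟩
    exact ⟨L (T y), ⟨T y, rfl⟩, rfl⟩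
  exact (Submodule.finrank_mono h).trans (Submodule.finrank_map_le _ _)

/-- Conjugation bounds the rank at `ρ(g) v` by the rank at `v`; the same bound for `g⁻¹` gives the
converse. -/
theorem finrank_range_infAct (hρ : ContMDiff 𝓘(ℝ, E) 𝓘(ℝ, V →L[ℝ] V) ∞ ρ) (v : V) (g : G) :
    Module.finrank ℝ (LinearMap.range (infAct E ρ (ρ g v) : E →ₗ[ℝ] V)) =
      Module.finrank ℝ (LinearMap.range (infAct E ρ v : E →ₗ[ℝ] V)) := by
  have key : ∀ (v : V) (g : G),
      Module.finrank ℝ (LinearMap.range (infAct E ρ (ρ g v) : E →ₗ[ℝ] V)) ≤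
        Module.finrank ℝ (LinearMap.range (infAct E ρ v : E →ₗ[ℝ] V)) := by
    intro v g
    obtain ⟨T, hT⟩ := infAct_rep hρ v g
    rw [hT]
    exact finrank_range_comp_comp_le _ _ _
  refine le_antisymm (key v g) ?_
  have h := key (ρ g v) g⁻¹
  rwa [rep_inv_apply] at h

variable [FiniteDimensional ℝ E] [CompactSpace G]
  {A : Type*} [NormedAddCommGroup A] [NormedSpace ℝ A] [FiniteDimensional ℝ A]

/-- The orbit of `x` is a graph near `x`. -/
theorem exists_graphChart_self (hρ : ContMDiff 𝓘(ℝ, E) 𝓘(ℝ, V →L[ℝ] V) ∞ ρ) (x : V)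
    (hA : Module.finrank ℝ (LinearMap.range (infAct E ρ x : E →ₗ[ℝ] V)) =
      Module.finrank ℝ A) :
    ∃ c : GraphChart A (repOrbit ρ x), x ∈ c.dom := by
  let e := extChartAt 𝓘(ℝ, E) (1 : G)
  let f : G → V := fun g => ρ g x
  have hf : ContMDiff 𝓘(ℝ, E) 𝓘(ℝ, V) ∞ f := contMDiff_rep_apply hρ x
  have hfcont : Continuous f := hf.continuous
  have hΩ : IsOpen e.target := isOpen_extChartAt_target (1 : G)
  have hsm : ContMDiffOn 𝓘(ℝ, E) 𝓘(ℝ, E) ∞ e.symm e.target := contMDiffOn_extChartAt_symm (1 : G)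
  have hfe : ContDiffOn ℝ ∞ (f ∘ e.symm) e.target :=
    contMDiffOn_iff_contDiffOn.1 (hf.comp_contMDiffOn hsm)
  have hd : ∀ y ∈ e.target, ∀ D : E →L[ℝ] V, HasMFDerivAt 𝓘(ℝ, E) 𝓘(ℝ, V) f (e.symm y) D →
      ∃ T : E →L[ℝ] E, fderiv ℝ (f ∘ e.symm) y = D.comp T := by
    intro y hy D hD
    let T : E →L[ℝ] E := mfderiv 𝓘(ℝ, E) 𝓘(ℝ, E) e.symm y
    have h1 : HasMFDerivAt 𝓘(ℝ, E) 𝓘(ℝ, E) e.symm y T :=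
      ((hsm.contMDiffAt (hΩ.mem_nhds hy)).mdifferentiableAt (by simp)).hasMFDerivAt
    have h2 : HasFDerivAt (f ∘ e.symm) (D.comp T) y :=
      hasMFDerivAt_iff_hasFDerivAt.1 (hD.comp y h1)
    exact ⟨T, h2.fderiv⟩
  have hy₀ : e 1 ∈ e.target := mem_extChartAt_target (1 : G)
  have hd₀ : fderiv ℝ (f ∘ e.symm) (e 1) = infAct E ρ x := by
    have h1 : HasMFDerivAt 𝓘(ℝ, E) 𝓘(ℝ, V) f 1 (infAct E ρ x) := hasMFDerivAt_rep_apply hρ x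
    have h2 : HasFDerivWithinAt (f ∘ e.symm) (infAct E ρ x) (Set.range 𝓘(ℝ, E)) (e 1) := h1.2
    rw [ModelWithCorners.range_eq_univ] at h2
    exact h2.hasFDerivAt_of_univ.fderiv
  have hrank₀ : Module.finrank ℝ (LinearMap.range (fderiv ℝ (f ∘ e.symm) (e 1) : E →ₗ[ℝ] V)) =
      Module.finrank ℝ A := by rw [hd₀, hA]
  have hrank : ∀ y ∈ e.target, Module.finrank ℝ
      (LinearMap.range (fderiv ℝ (f ∘ e.symm) y : E →ₗ[ℝ] V)) ≤ Module.finrank ℝ A := by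
    intro y hy
    obtain ⟨T, D, hD, hT⟩ := hasMFDerivAt_rep_apply_left hρ x (e.symm y)
    obtain ⟨T', hT'⟩ := hd y hy _ hT
    rw [hT', hD, ← hA, ContinuousLinearMap.comp_assoc, ContinuousLinearMap.comp_assoc]
    exact finrank_range_comp_comp_le _ _ _
  obtain ⟨N, D, P, h, hN, hyN, hNΩ, hD, hh, himg, hPh⟩ :=
    exists_section_of_finrank_le hΩ hfe hy₀ hrank₀ hrank
  let N' : Set G := e.source ∩ e ⁻¹' N
  have hN' : IsOpen N' :=
    (continuousOn_extChartAt (1 : G)).isOpen_inter_preimage (isOpen_extChartAt_source 1) hN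
  have hfN : f '' N' = h '' D := by
    rw [← himg]
    ext v
    constructor
    · rintro ⟨g, ⟨hg, hg'⟩, rfl⟩
      exact ⟨e g, hg', congrArg f (e.left_inv hg)⟩
    · rintro ⟨y, hy, rfl⟩
      refine ⟨e.symm y, ⟨e.map_target (hNΩ hy), ?_⟩, rfl⟩
      rw [Set.mem_preimage, e.right_inv (hNΩ hy)]
      exact hy
  -- The saturation of `N'` is open because it is a union of right translates of `N'` by elements of
  -- the stabilizer of `x`.
  have hsat : IsOpen (f ⁻¹' (f '' N')) := by
    have heq : f ⁻¹' (f '' N') = ⋃ k ∈ {k : G | ρ k x = x}, (fun g => g * k) ⁻¹' N' := by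
      ext g
      simp only [Set.mem_preimage, Set.mem_image, Set.mem_iUnion, Set.mem_ofPred_eq, exists_prop]
      constructor
      · rintro ⟨n, hn, hng⟩
        refine ⟨g⁻¹ * n, ?_, by rwa [mul_inv_cancel_left]⟩
        rw [rep_mul_apply, show ρ n x = ρ g x from hng, rep_inv_apply]
      · rintro ⟨k, hk, hgk⟩
        exact ⟨g * k, hgk, by change ρ (g * k) x = ρ g x; rw [rep_mul_apply, hk]⟩
    have : ContinuousMul G := continuousMul_of_contMDiffMul 𝓘(ℝ, E) ∞
    rw [heq]
    exact isOpen_biUnion fun k _ => hN'.preimage (continuous_mul_const k)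
  -- This set is the part of the orbit outside `f '' N'`. It is compact as the image of a closed
  -- subset of `G`, so its complement is an ambient open set that meets the orbit exactly in the
  -- graph `h '' D`.
  have hcl : IsClosed (f '' (f ⁻¹' (f '' N'))ᶜ) :=
    (hsat.isClosed_compl.isCompact.image hfcont).isClosed
  have hmem : ∀ s ∈ repOrbit ρ x, s ∉ f '' (f ⁻¹' (f '' N'))ᶜ → s ∈ h '' D := by
    rintro _ ⟨g, rfl⟩ hs
    by_contra hcon
    rw [← hfN] at hcon
    exact hs ⟨g, hcon, rfl⟩
  refine ⟨⟨(f '' (f ⁻¹' (f '' N'))ᶜ)ᶜ, D, P, h, hcl.isOpen_compl, hD, hh, ?_, ?_, hPh, ?_, ?_⟩, ?_⟩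
  · intro t ht
    obtain ⟨g, -, hg⟩ : h t ∈ f '' N' := hfN ▸ ⟨t, ht, rfl⟩
    exact ⟨g, hg⟩
  · rintro t ht ⟨g, hg, hgt⟩
    refine hg ?_
    rw [Set.mem_preimage, hgt, hfN]
    exact ⟨t, ht, rfl⟩
  · intro s hs hs'
    obtain ⟨t, ht, rfl⟩ := hmem s hs hs'
    rwa [hPh t ht]
  · intro s hs hs'
    obtain ⟨t, ht, rfl⟩ := hmem s hs hs'
    rw [hPh t ht]
  · rintro ⟨g, hg, hgx⟩
    refine hg ?_
    rw [Set.mem_preimage, hgx]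
    exact ⟨1, ⟨mem_extChartAt_source 1, hyN⟩, by change ρ 1 x = x; rw [map_one]; rfl⟩

/-- Orbits of compact groups are locally graphs. -/
theorem exists_graphChart_repOrbit (hρ : ContMDiff 𝓘(ℝ, E) 𝓘(ℝ, V →L[ℝ] V) ∞ ρ) (x : V)
    (hA : Module.finrank ℝ (LinearMap.range (infAct E ρ x : E →ₗ[ℝ] V)) =
      Module.finrank ℝ A) (w : repOrbit ρ x) :
    ∃ c : GraphChart A (repOrbit ρ x), w.1 ∈ c.dom := by
  obtain ⟨c, hc⟩ := exists_graphChart_self hρ x hA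
  obtain ⟨_, g, rfl⟩ := w
  refine ⟨c.map (repEquiv ρ g) fun s => rep_mem_repOrbit_iff ρ x g s, ?_⟩
  change ρ g⁻¹ (ρ g x) ∈ c.dom
  rwa [rep_inv_apply]

omit [FiniteDimensional ℝ V] [FiniteDimensional ℝ E] [CompactSpace G]
  [FiniteDimensional ℝ A] [LieGroup 𝓘(ℝ, E) ∞ G] in
/-- Infinitesimal orbit directions are tangent to the orbit. -/
theorem infAct_eq_fderiv_sec (hρ : ContMDiff 𝓘(ℝ, E) 𝓘(ℝ, V →L[ℝ] V) ∞ ρ) {x : V}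
    (c : GraphChart A (repOrbit ρ x)) {w : V} (hw : w ∈ repOrbit ρ x) (hwc : w ∈ c.dom) :
    infAct E ρ w =
      (fderiv ℝ c.sec (c.proj w)).comp (c.proj.comp (infAct E ρ w)) := by
  have h1 := hasMFDerivAt_rep_apply hρ w
  have hone : ρ 1 w = w := by rw [map_one]; rfl
  have h2 : HasMFDerivAt 𝓘(ℝ, V) 𝓘(ℝ, A) c.proj (ρ 1 w) c.proj := c.proj.hasMFDerivAt
  have h3 : HasMFDerivAt 𝓘(ℝ, A) 𝓘(ℝ, V) c.sec (c.proj (ρ 1 w)) (fderiv ℝ c.sec (c.proj w)) := by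
    rw [hone]
    exact (c.hasFDerivAt_sec (c.proj_mem w hw hwc)).hasMFDerivAt
  have h4 := h3.comp (1 : G) (h2.comp (1 : G) h1)
  have h5 : (fun g : G => ρ g w) =ᶠ[𝓝 1] c.sec ∘ c.proj ∘ fun g : G => ρ g w := by
    have hcont : Continuous (fun g : G => ρ g w) := (contMDiff_rep_apply hρ w).continuous
    refine Filter.eventuallyEq_of_mem ((c.isOpen_dom.preimage hcont).mem_nhds ?_) fun g hg => ?_
    · rw [Set.mem_preimage, hone]
      exact hwc
    · exact (c.sec_proj _ ((rep_mem_repOrbit_iff ρ x g w).2 hw) hg).symm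
  exact h1.mfderiv.symm.trans (h4.congr_of_eventuallyEq h5).mfderiv

omit [CompactSpace G] [FiniteDimensional ℝ E] in
/-- The infinitesimal action spans the tangent space of the orbit. -/
theorem proj_infAct_surjective (hρ : ContMDiff 𝓘(ℝ, E) 𝓘(ℝ, V →L[ℝ] V) ∞ ρ) {x : V}
    (hA : Module.finrank ℝ (LinearMap.range (infAct E ρ x : E →ₗ[ℝ] V)) =
      Module.finrank ℝ A)
    (c : GraphChart A (repOrbit ρ x)) {w : V} (hw : w ∈ repOrbit ρ x) (hwc : w ∈ c.dom) :
    Function.Surjective (c.proj.comp (infAct E ρ w)) := by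
  have hfac := infAct_eq_fderiv_sec hρ c hw hwc
  have hfr : Module.finrank ℝ (LinearMap.range (infAct E ρ w : E →ₗ[ℝ] V)) =
      Module.finrank ℝ A := by
    obtain ⟨g, rfl⟩ := hw
    exact (finrank_range_infAct hρ x g).trans hA
  let Q : LinearMap.range (infAct E ρ w : E →ₗ[ℝ] V) →ₗ[ℝ] A :=
    (c.proj : V →ₗ[ℝ] A) ∘ₗ (LinearMap.range (infAct E ρ w : E →ₗ[ℝ] V)).subtype
  -- A vector `u` in the range satisfies `u = D sec (proj u)`, hence vanishes if `proj u = 0`.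
  -- Equality of dimensions then upgrades injectivity to surjectivity.
  have hQ : Function.Injective Q := by
    rw [injective_iff_map_eq_zero]
    rintro ⟨_, y, rfl⟩ hy
    refine Subtype.ext ?_
    have h1 : c.proj (infAct E ρ w y) = 0 := hy
    have h2 := DFunLike.congr_fun hfac y
    simp only [ContinuousLinearMap.comp_apply, h1, map_zero] at h2
    exact h2
  intro a
  obtain ⟨⟨_, y, rfl⟩, hy⟩ :=
    (LinearMap.injective_iff_surjective_of_finrank_eq_finrank hfr).1 hQ a
  exact ⟨y, hy⟩

end Orbit

/-! ### The bracket of the Lie algebra acts by commutators -/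

section Bracket

variable {E : Type*} [NormedAddCommGroup E] [NormedSpace ℝ E]
  {H : Type*} [TopologicalSpace H] {I : ModelWithCorners ℝ E H} [I.Boundaryless]
  {M : Type*} [TopologicalSpace M] [ChartedSpace H M]
  {V : Type*} [NormedAddCommGroup V] [NormedSpace ℝ V]

/-- The derivative of a vector-valued function is the derivative of its expression in the
preferred chart. -/
theorem hasFDerivAt_extChartAt_of_hasMFDerivAt {F : M → V} {x : M} {D : E →L[ℝ] V}
    (hF : HasMFDerivAt I 𝓘(ℝ, V) F x D) :
    HasFDerivAt (F ∘ (extChartAt I x).symm) D (extChartAt I x x) := by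
  have h : HasFDerivWithinAt (F ∘ (extChartAt I x).symm) D (Set.range I)
      (extChartAt I x x) := hF.2
  rw [ModelWithCorners.range_eq_univ] at h
  exact h.hasFDerivAt_of_univ

/-- The product rule produces second derivatives of `F`, which cancel by symmetry and leave only the
derivatives of the fields. -/
theorem fderiv_lieBracket_apply {F : E → V} {X Y : E → E} {y : E} (hF : ContDiffAt ℝ ∞ F y)
    (hX : DifferentiableAt ℝ X y) (hY : DifferentiableAt ℝ Y y) :
    fderiv ℝ F y (VectorField.lieBracket ℝ X Y y) =
      fderiv ℝ (fun z => fderiv ℝ F z (Y z)) y (X y) -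
        fderiv ℝ (fun z => fderiv ℝ F z (X z)) y (Y y) := by
  have hF' : DifferentiableAt ℝ (fderiv ℝ F) y :=
    (hF.fderiv_right (m := 1) (by rw [one_add_one_eq_two]; exact ENat.LEInfty.out)).differentiableAt (by simp)
  have hsymm : fderiv ℝ (fderiv ℝ F) y (X y) (Y y) = fderiv ℝ (fderiv ℝ F) y (Y y) (X y) :=
    (hF.isSymmSndFDerivAt (by simpa using ENat.LEInfty.out)).eq _ _
  rw [(hF'.hasFDerivAt.clm_apply hX.hasFDerivAt).fderiv,
    (hF'.hasFDerivAt.clm_apply hY.hasFDerivAt).fderiv, VectorField.lieBracket]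
  simp only [add_apply, ContinuousLinearMap.comp_apply,
    ContinuousLinearMap.flip_apply, map_sub, hsymm]
  abel

variable [IsManifold I ∞ M] [CompleteSpace E]

/-- The Lie bracket of vector fields is the commutator of derivations. -/
theorem mfderiv_mlieBracket_apply {F : M → V} (hF : ContMDiff I 𝓘(ℝ, V) ∞ F)
    {X Y : ∀ p : M, TangentSpace I p} {x : M}
    (hX : MDifferentiableAt I I.tangent (fun p => (X p : TangentBundle I M)) x)
    (hY : MDifferentiableAt I I.tangent (fun p => (Y p : TangentBundle I M)) x)
    {FX FY : M → V} (hFX : ∀ p, FX p = mfderiv I 𝓘(ℝ, V) F p (X p))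
    (hFY : ∀ p, FY p = mfderiv I 𝓘(ℝ, V) F p (Y p))
    {DF DFX DFY : E →L[ℝ] V} (hDF : HasMFDerivAt I 𝓘(ℝ, V) F x DF)
    (hDFX : HasMFDerivAt I 𝓘(ℝ, V) FX x DFX) (hDFY : HasMFDerivAt I 𝓘(ℝ, V) FY x DFY) :
    DF (VectorField.mlieBracket I X Y x) = DFY (X x) - DFX (Y x) := by
  set e := extChartAt I x with he
  have hopen : IsOpen e.target := isOpen_extChartAt_target x
  have hy : e x ∈ e.target := mem_extChartAt_target x
  have : IsManifold I 2 M := .of_le (n := ∞) ENat.LEInfty.out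
  have hesm : ContMDiffOn 𝓘(ℝ, E) I ∞ e.symm e.target := contMDiffOn_extChartAt_symm x
  -- pullbacks of vector fields to the chart
  let pb : (∀ p : M, TangentSpace I p) → E → E := fun Z =>
    VectorField.mpullbackWithin 𝓘(ℝ, E) I e.symm Z (Set.range I)
  have hpbd : ∀ Z : ∀ p : M, TangentSpace I p,
      MDifferentiableAt I I.tangent (fun p => (Z p : TangentBundle I M)) x →
      DifferentiableAt ℝ (pb Z) (e x) := by
    intro Z hZ
    have h := MDifferentiableWithinAt.differentiableWithinAt_mpullbackWithin_vectorField
      (mdifferentiableWithinAt_univ.2 hZ)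
    rw [Set.preimage_univ, Set.univ_inter, ModelWithCorners.range_eq_univ] at h
    have h' := differentiableWithinAt_univ.1 h
    simp only [pb, ModelWithCorners.range_eq_univ]
    exact h'
  have hpb : ∀ (Z : ∀ p : M, TangentSpace I p) (y : E), y ∈ e.target →
      mfderiv 𝓘(ℝ, E) I e.symm y (pb Z y) = Z (e.symm y) := by
    intro Z y hy
    have hinv := isInvertible_mfderivWithin_extChartAt_symm (I := I) hy
    have h : mfderivWithin 𝓘(ℝ, E) I e.symm (Set.range I) y (pb Z y) = Z (e.symm y) :=
      hinv.self_apply_inverse _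
    rw [ModelWithCorners.range_eq_univ, mfderivWithin_univ] at h
    exact h
  have hpbx : ∀ Z : ∀ p : M, TangentSpace I p, pb Z (e x) = Z x := by
    intro Z
    let T : E →L[ℝ] E := mfderivWithin 𝓘(ℝ, E) I e.symm (Set.range I) (e x)
    have hT : T = ContinuousLinearMap.id ℝ E := mfderivWithin_range_extChartAt_symm
    have h : pb Z (e x) = ContinuousLinearMap.inverse T (Z (e.symm (e x))) := rfl
    rw [h, hT, ContinuousLinearMap.inverse_id, he, extChartAt_to_inv]
    rfl
  have hFe : ContDiffAt ℝ ∞ (F ∘ e.symm) (e x) :=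
    (contMDiffOn_iff_contDiffOn.1 (hF.comp_contMDiffOn hesm)).contDiffAt (hopen.mem_nhds hy)
  have hcomp : ∀ (Z : ∀ p : M, TangentSpace I p) (FZ : M → V),
      (∀ p, FZ p = mfderiv I 𝓘(ℝ, V) F p (Z p)) →
      (FZ ∘ e.symm) =ᶠ[𝓝 (e x)] fun y => fderiv ℝ (F ∘ e.symm) y (pb Z y) := by
    intro Z FZ hFZ
    refine Filter.eventuallyEq_of_mem (hopen.mem_nhds hy) fun y hy => ?_
    have h1 : MDifferentiableAt 𝓘(ℝ, E) I e.symm y :=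
      (hesm.contMDiffAt (hopen.mem_nhds hy)).mdifferentiableAt (by simp)
    have h2 := mfderiv_comp_apply y ((hF (e.symm y)).mdifferentiableAt (by simp)) h1 (pb Z y)
    rw [hpb Z y hy, ← hFZ, mfderiv_eq_fderiv] at h2
    exact h2.symm
  -- The preferred chart at `x` has identity differential at `x`, so no correction factor appears
  -- when the bracket is computed there.
  have hbr : (VectorField.mlieBracket I X Y x : E) =
      VectorField.lieBracket ℝ (pb X) (pb Y) (e x) := by
    let T : E →L[ℝ] E := mfderiv I 𝓘(ℝ, E) e x
    have hT : T = ContinuousLinearMap.id ℝ E := mfderiv_extChartAt_self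
    have h : (VectorField.mlieBracket I X Y x : E) = ContinuousLinearMap.inverse T
      (VectorField.lieBracketWithin ℝ (pb X) (pb Y) (e.symm ⁻¹' Set.univ ∩ Set.range I) (e x)) :=
      rfl
    rw [h, hT, ContinuousLinearMap.inverse_id, Set.preimage_univ, Set.univ_inter,
      ModelWithCorners.range_eq_univ, VectorField.lieBracketWithin_univ]
    rfl
  have key := fderiv_lieBracket_apply hFe (hpbd X hX) (hpbd Y hY)
  rw [← (hcomp X FX hFX).fderiv_eq, ← (hcomp Y FY hFY).fderiv_eq, hpbx, hpbx, ← hbr,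
    (hasFDerivAt_extChartAt_of_hasMFDerivAt hDF).fderiv,
    (hasFDerivAt_extChartAt_of_hasMFDerivAt hDFX).fderiv,
    (hasFDerivAt_extChartAt_of_hasMFDerivAt hDFY).fderiv] at key
  exact key

/-- The differential of a representation is a morphism of Lie algebras. -/
theorem mfderiv_rep_bracket {L : Type*} [TopologicalSpace L] [ChartedSpace H L] [Group L]
    [LieGroup I ∞ L] {R : L →* (V →L[ℝ] V)} (hR : ContMDiff I 𝓘(ℝ, V →L[ℝ] V) ∞ R)
    (D : E →L[ℝ] V →L[ℝ] V) (hD : HasMFDerivAt I 𝓘(ℝ, V →L[ℝ] V) R 1 D)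
    (X Y : GroupLieAlgebra I L) :
    D (⁅X, Y⁆ : GroupLieAlgebra I L) = D X * D Y - D Y * D X := by
  have : LieGroup I (minSmoothness ℝ 3) L := .of_le (n := ∞) (by simpa using ENat.LEInfty.out)
  -- Along the left-invariant field of `Z` the derivative of `R` at `g` is `R g * D Z`, because `R
  -- (g k) = R g * R k`. Differentiating this once more at `1` gives the two products of the
  -- commutator.
  have hder : ∀ (Z : GroupLieAlgebra I L) (g : L),
      R g * D Z = mfderiv I 𝓘(ℝ, V →L[ℝ] V) R g (mulInvariantVectorField Z g) := by
    intro Z g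
    have h1 : HasMFDerivAt I I (fun k : L => g * k) 1 (mfderiv I I (fun k : L => g * k) 1) :=
      ((contMDiff_mul_left (I := I) (n := ∞) (a := g) 1).mdifferentiableAt
        (by simp)).hasMFDerivAt
    have h2 : HasMFDerivAt I 𝓘(ℝ, V →L[ℝ] V) R (g * 1) (mfderiv I 𝓘(ℝ, V →L[ℝ] V) R (g * 1)) :=
      ((hR _).mdifferentiableAt (by simp)).hasMFDerivAt
    have h3 := (h2.comp (1 : L) h1).mfderiv
    have h4 : (R ∘ fun k : L => g * k) =
        ContinuousLinearMap.mul ℝ (V →L[ℝ] V) (R g) ∘ R := by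
      funext k
      simp
    have h5 : HasMFDerivAt 𝓘(ℝ, V →L[ℝ] V) 𝓘(ℝ, V →L[ℝ] V)
        (ContinuousLinearMap.mul ℝ (V →L[ℝ] V) (R g)) (R 1)
        (ContinuousLinearMap.mul ℝ (V →L[ℝ] V) (R g)) :=
      (ContinuousLinearMap.mul ℝ (V →L[ℝ] V) (R g)).hasMFDerivAt
    have h6 := (h5.comp (1 : L) hD).mfderiv
    rw [h4, h6] at h3
    have h7 := DFunLike.congr_fun h3 Z
    rw [mul_one] at h7
    exact h7
  have hmul : ∀ T : V →L[ℝ] V, HasMFDerivAt I 𝓘(ℝ, V →L[ℝ] V) (fun g : L => R g * T) 1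
      (((ContinuousLinearMap.mul ℝ (V →L[ℝ] V)).flip T).comp D) := by
    intro T
    have h5 : HasMFDerivAt 𝓘(ℝ, V →L[ℝ] V) 𝓘(ℝ, V →L[ℝ] V)
        ((ContinuousLinearMap.mul ℝ (V →L[ℝ] V)).flip T) (R 1)
        ((ContinuousLinearMap.mul ℝ (V →L[ℝ] V)).flip T) :=
      ((ContinuousLinearMap.mul ℝ (V →L[ℝ] V)).flip T).hasMFDerivAt
    exact h5.comp (1 : L) hD
  have hinv1 : ∀ Z : GroupLieAlgebra I L, mulInvariantVectorField Z (1 : L) = Z := by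
    intro Z
    have h : (fun k : L => 1 * k) = id := by funext k; simp
    simp only [mulInvariantVectorField]
    rw [h, mfderiv_id]
    rfl
  have key := mfderiv_mlieBracket_apply hR (x := (1 : L))
    (mdifferentiableAt_mulInvariantVectorField X) (mdifferentiableAt_mulInvariantVectorField Y)
    (hder X) (hder Y) hD (hmul _) (hmul _)
  rw [hinv1, hinv1, ← GroupLieAlgebra.bracket_def] at key
  exact key

end Bracket

/-! ### Cotangent coordinates -/

section CotangentCoordinates

variable {A : Type*} [NormedAddCommGroup A] [NormedSpace ℝ A]
  {M : Type*} [TopologicalSpace M] [ChartedSpace A M] [IsManifold 𝓘(ℝ, A) ∞ M]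

theorem mem_extChartAt_cotangent_source (γ₀ γ : CotangentBundle 𝓘(ℝ, A) M) :
    γ ∈ (extChartAt (cotangentModel 𝓘(ℝ, A)) γ₀).source ↔ γ.proj ∈ (chartAt A γ₀.proj).source := by
  rw [FiberBundle.extChartAt]
  simp only [PartialEquiv.trans_source, hom_trivializationAt_source,
    PartialEquiv.prod_source, PartialEquiv.refl_source, extChartAt_source, Set.mem_inter_iff,
    Set.mem_preimage, Set.mem_prod, Set.mem_univ, and_true]
  exact ⟨fun h => h.1.1, fun h => ⟨⟨h, trivial⟩, h⟩⟩

theorem extChartAt_cotangent_target (γ₀ : CotangentBundle 𝓘(ℝ, A) M) :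
    (extChartAt (cotangentModel 𝓘(ℝ, A)) γ₀).target =
      (extChartAt 𝓘(ℝ, A) γ₀.proj).target ×ˢ Set.univ := by
  rw [FiberBundle.extChartAt_target, hom_trivializationAt_baseSet]
  congr 1
  refine Set.inter_eq_left.2 fun t ht => ?_
  refine ⟨?_, trivial⟩
  have h := (extChartAt 𝓘(ℝ, A) γ₀.proj).map_target ht
  rwa [extChartAt_source] at h

theorem extChartAt_cotangent_apply (γ₀ γ : CotangentBundle 𝓘(ℝ, A) M) :
    extChartAt (cotangentModel 𝓘(ℝ, A)) γ₀ γ = (extChartAt 𝓘(ℝ, A) γ₀.proj γ.proj,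
      ContinuousLinearMap.inCoordinates A (TangentSpace 𝓘(ℝ, A)) ℝ (Bundle.Trivial M ℝ)
        γ₀.proj γ.proj γ₀.proj γ.proj γ.snd) := by
  rw [FiberBundle.extChartAt]
  rfl

/-- The trivialization of the dual bundle precomposes with the inverse of the tangent
trivialization, and the latter is the differential of the chart. This is what lets a covector be
compared in different charts. -/
theorem cotangent_snd_apply (γ₀ γ : CotangentBundle 𝓘(ℝ, A) M)
    (h : γ.proj ∈ (chartAt A γ₀.proj).source) (a : TangentSpace 𝓘(ℝ, A) γ.proj) :
    γ.snd a = (extChartAt (cotangentModel 𝓘(ℝ, A)) γ₀ γ).2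
      (mfderiv 𝓘(ℝ, A) 𝓘(ℝ, A) (extChartAt 𝓘(ℝ, A) γ₀.proj) γ.proj a) := by
  rw [extChartAt_cotangent_apply, ← TangentBundle.continuousLinearMapAt_trivializationAt h]
  have hb : γ.proj ∈ (trivializationAt A (TangentSpace 𝓘(ℝ, A)) γ₀.proj).baseSet := h
  have h1 := (trivializationAt A (TangentSpace 𝓘(ℝ, A)) γ₀.proj).symmL_continuousLinearMapAt
    (R := ℝ) hb a
  refine (congrArg γ.snd h1.symm).trans ?_
  exact (DFunLike.congr_fun
    (Bundle.Trivial.continuousLinearMapAt_trivialization ℝ M ℝ γ.proj) _).symm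

/-- In cotangent coordinates `(q, p)`, the tautological form is `p dq`. -/
theorem tautologicalForm_extChartAt_symm (γ₀ : CotangentBundle 𝓘(ℝ, A) M) (y : A × (A →L[ℝ] ℝ))
    (hy : y ∈ (extChartAt (cotangentModel 𝓘(ℝ, A)) γ₀).target) (a : A × (A →L[ℝ] ℝ)) :
    tautologicalForm 𝓘(ℝ, A) M ((extChartAt (cotangentModel 𝓘(ℝ, A)) γ₀).symm y)
      (mfderiv 𝓘(ℝ, A × (A →L[ℝ] ℝ)) (cotangentModel 𝓘(ℝ, A))
        (extChartAt (cotangentModel 𝓘(ℝ, A)) γ₀).symm y a) = y.2 a.1 := by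
  set e := extChartAt (cotangentModel 𝓘(ℝ, A)) γ₀ with he
  have hopen : IsOpen e.target := isOpen_extChartAt_target γ₀
  set γ := e.symm y with hγ
  have hsrc : γ.proj ∈ (chartAt A γ₀.proj).source :=
    (mem_extChartAt_cotangent_source γ₀ γ).1 (e.map_target hy)
  have hproj : MDifferentiableAt (cotangentModel 𝓘(ℝ, A)) 𝓘(ℝ, A)
      (fun γ' : CotangentBundle 𝓘(ℝ, A) M => γ'.proj) γ :=
    (Bundle.contMDiffAt_proj (n := ∞) _).mdifferentiableAt (by simp)
  have hsymm : MDifferentiableAt 𝓘(ℝ, A × (A →L[ℝ] ℝ)) (cotangentModel 𝓘(ℝ, A)) e.symm y :=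
    ((contMDiffOn_extChartAt_symm (n := ∞) γ₀).contMDiffAt
      (hopen.mem_nhds hy)).mdifferentiableAt (by simp)
  have hchart : MDifferentiableAt 𝓘(ℝ, A) 𝓘(ℝ, A) (extChartAt 𝓘(ℝ, A) γ₀.proj) γ.proj :=
    mdifferentiableAt_extChartAt hsrc
  have h1 : HasMFDerivAt 𝓘(ℝ, A × (A →L[ℝ] ℝ)) 𝓘(ℝ, A)
      (extChartAt 𝓘(ℝ, A) γ₀.proj ∘ (fun γ' : CotangentBundle 𝓘(ℝ, A) M => γ'.proj) ∘ e.symm) y _ :=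
    hchart.hasMFDerivAt.comp y (hproj.hasMFDerivAt.comp y hsymm.hasMFDerivAt)
  -- In cotangent coordinates the bundle projection is the first projection, so the two computations
  -- of its differential must agree.
  have h2 : HasMFDerivAt 𝓘(ℝ, A × (A →L[ℝ] ℝ)) 𝓘(ℝ, A)
      (extChartAt 𝓘(ℝ, A) γ₀.proj ∘ (fun γ' : CotangentBundle 𝓘(ℝ, A) M => γ'.proj) ∘ e.symm) y
      (ContinuousLinearMap.fst ℝ A (A →L[ℝ] ℝ)) := by
    refine HasMFDerivAt.congr_of_eventuallyEq
      (ContinuousLinearMap.fst ℝ A (A →L[ℝ] ℝ)).hasMFDerivAt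
      (Filter.eventuallyEq_of_mem (hopen.mem_nhds hy) fun z hz => ?_)
    have h3 := extChartAt_cotangent_apply γ₀ (e.symm z)
    rw [← he, e.right_inv hz] at h3
    exact (congrArg Prod.fst h3).symm
  have h4 := DFunLike.congr_fun (h1.mfderiv.symm.trans h2.mfderiv) a
  have h5 := cotangent_snd_apply γ₀ γ hsrc (mfderiv (cotangentModel 𝓘(ℝ, A)) 𝓘(ℝ, A)
    (fun γ' : CotangentBundle 𝓘(ℝ, A) M => γ'.proj) γ
    (mfderiv 𝓘(ℝ, A × (A →L[ℝ] ℝ)) (cotangentModel 𝓘(ℝ, A)) e.symm y a))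
  have h6 : e γ = y := e.right_inv hy
  rw [← he, h6] at h5
  refine h5.trans ?_
  exact congrArg y.2 h4

/-- In cotangent coordinates, the canonical form is `∑ dqᵢ ∧ dpᵢ`. -/
theorem canonicalForm_eq (γ : CotangentBundle 𝓘(ℝ, A) M)
    (a b : TangentSpace (cotangentModel 𝓘(ℝ, A)) γ) (a' b' : A × (A →L[ℝ] ℝ))
    (ha : mfderiv (cotangentModel 𝓘(ℝ, A)) 𝓘(ℝ, A × (A →L[ℝ] ℝ))
      (extChartAt (cotangentModel 𝓘(ℝ, A)) γ) γ a = a')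
    (hb : mfderiv (cotangentModel 𝓘(ℝ, A)) 𝓘(ℝ, A × (A →L[ℝ] ℝ))
      (extChartAt (cotangentModel 𝓘(ℝ, A)) γ) γ b = b') :
    canonicalForm 𝓘(ℝ, A) M γ a b = b'.2 a'.1 - a'.2 b'.1 := by
  let P : (A →L[ℝ] ℝ) →L[ℝ] (A × (A →L[ℝ] ℝ)) →L[ℝ] ℝ :=
    (ContinuousLinearMap.compL ℝ (A × (A →L[ℝ] ℝ)) A ℝ).flip
      (ContinuousLinearMap.fst ℝ A (A →L[ℝ] ℝ))
  -- The coordinate expression `(q, p) ↦ p ∘ fst` of the tautological form is linear in the base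
  -- point, so it is its own derivative.
  let Q : (A × (A →L[ℝ] ℝ)) →L[ℝ] (A × (A →L[ℝ] ℝ)) →L[ℝ] ℝ :=
    P.comp (ContinuousLinearMap.snd ℝ A (A →L[ℝ] ℝ))
  let e := extChartAt (cotangentModel 𝓘(ℝ, A)) γ
  let αhat : A × (A →L[ℝ] ℝ) → ((A × (A →L[ℝ] ℝ)) →L[ℝ] ℝ) := fun y =>
    (tautologicalForm 𝓘(ℝ, A) M (e.symm y)).comp
      (mfderiv 𝓘(ℝ, A × (A →L[ℝ] ℝ)) (cotangentModel 𝓘(ℝ, A)) e.symm y)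
  have hopen : IsOpen e.target := isOpen_extChartAt_target γ
  have hα : αhat =ᶠ[𝓝 (e γ)] Q := by
    refine Filter.eventuallyEq_of_mem (hopen.mem_nhds (mem_extChartAt_target γ)) fun y hy => ?_
    refine ContinuousLinearMap.ext fun a => ?_
    exact tautologicalForm_extChartAt_symm γ y hy a
  have hd : fderiv ℝ αhat (e γ) = Q := by
    rw [hα.fderiv_eq]
    exact ContinuousLinearMap.fderiv (E := A × (A →L[ℝ] ℝ)) (F := (A × (A →L[ℝ] ℝ)) →L[ℝ] ℝ) Q
  have key : canonicalForm 𝓘(ℝ, A) M γ a b =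
      -(fderiv ℝ αhat (e γ) a' b' - fderiv ℝ αhat (e γ) b' a') := by
    rw [← ha, ← hb]
    rfl
  rw [key, hd]
  change -(a'.2 b'.1 - b'.2 a'.1) = _
  ring

end CotangentCoordinates

/-! ### Invariant inner products -/

section InvariantInner

open MeasureTheory

variable {G : Type*} [Group G] [TopologicalSpace G] [IsTopologicalGroup G] [CompactSpace G]
  {V : Type*} [NormedAddCommGroup V] [NormedSpace ℝ V] [FiniteDimensional ℝ V]

/-- A continuous representation of a compact group admits an invariant inner product, obtained by
averaging over the group. -/
theorem exists_isInvariantInner (ρ : G →* (V →L[ℝ] V)) (hρ : Continuous ρ) :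
    ∃ B : V →L[ℝ] V →L[ℝ] ℝ, IsInvariantInner ρ B := by
  let : MeasurableSpace G := borel G
  have : BorelSpace G := ⟨rfl⟩
  let μ : Measure G := Measure.haar
  let K : V ≃L[ℝ] EuclideanSpace ℝ (Fin (Module.finrank ℝ V)) :=
    ContinuousLinearEquiv.ofFinrankEq (by simp)
  -- With `g⁻¹` in the integrand, acting by `h` on both vectors becomes the left translation `g ↦
  -- h⁻¹ g`, under which Haar measure is invariant.
  let F : V → V → G → ℝ := fun v w g => inner ℝ (K (ρ g⁻¹ v)) (K (ρ g⁻¹ w))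
  have hFc : ∀ v w, Continuous (F v w) := fun v w => by
    have hK : ∀ v, Continuous fun g : G => K (ρ g⁻¹ v) := fun v =>
      K.continuous.comp ((hρ.comp continuous_inv).clm_apply continuous_const)
    exact (hK v).inner (hK w)
  have hFi : ∀ v w, Integrable (F v w) μ := fun v w =>
    (hFc v w).integrable_of_hasCompactSupport (.of_compactSpace _)
  let B : V →ₗ[ℝ] V →ₗ[ℝ] ℝ := LinearMap.mk₂ ℝ (fun v w => ∫ g, F v w g ∂μ)
    (fun v v' w => by
      rw [← integral_add (hFi v w) (hFi v' w)]
      simp [F, inner_add_left])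
    (fun r v w => by
      rw [smul_eq_mul, ← integral_const_mul]
      simp [F, inner_smul_left])
    (fun v w w' => by
      rw [← integral_add (hFi v w) (hFi v w')]
      simp [F, inner_add_right])
    (fun r v w => by
      rw [smul_eq_mul, ← integral_const_mul]
      simp [F, inner_smul_right])
  have hB : ∀ v w, B.toContinuousBilinearMap v w = ∫ g, F v w g ∂μ := fun v w => rfl
  refine ⟨B.toContinuousBilinearMap, ⟨?_, ?_, ?_⟩⟩
  · intro v w
    rw [hB, hB]
    exact integral_congr_ae (Filter.Eventually.of_forall fun g => real_inner_comm _ _)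
  · intro v hv
    rw [hB]
    refine (hFc v v).integral_pos_of_hasCompactSupport_nonneg_nonzero (x := 1)
      (.of_compactSpace _) (fun g => real_inner_self_nonneg) ?_
    have h : K (ρ 1⁻¹ v) ≠ 0 := by simpa using hv
    exact inner_self_ne_zero.2 h
  · intro h v w
    rw [hB, hB, ← integral_mul_left_eq_self (F v w) h⁻¹]
    refine integral_congr_ae (Filter.Eventually.of_forall fun g => ?_)
    simp [F]

end InvariantInner

/-! ### The Lie algebra of a semi-direct product -/

section SemidirectAlgebra

variable {E : Type*} [NormedAddCommGroup E] [NormedSpace ℝ E]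
  {G : Type*} [Group G] [TopologicalSpace G] [ChartedSpace E G] [LieGroup 𝓘(ℝ, E) ∞ G]
  {V : Type*} [NormedAddCommGroup V] [NormedSpace ℝ V]
  {ρ : G →* (V →L[ℝ] V)}

omit [LieGroup 𝓘(ℝ, E) ∞ G] in
theorem hasMFDerivAt_toG (a : SemidirectGroup ρ) :
    HasMFDerivAt (semidirectModel E V) 𝓘(ℝ, E) (SemidirectGroup.toG ρ) a
      (ContinuousLinearMap.fst ℝ E V) :=
  hasMFDerivAt_fst (I := 𝓘(ℝ, E)) (I' := 𝓘(ℝ, V)) (M := G) (M' := V) a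

omit [LieGroup 𝓘(ℝ, E) ∞ G] in
theorem hasMFDerivAt_toV (a : SemidirectGroup ρ) :
    HasMFDerivAt (semidirectModel E V) 𝓘(ℝ, V) (SemidirectGroup.toV ρ) a
      (ContinuousLinearMap.snd ℝ E V) :=
  hasMFDerivAt_snd (I := 𝓘(ℝ, E)) (I' := 𝓘(ℝ, V)) (M := G) (M' := V) a

omit [LieGroup 𝓘(ℝ, E) ∞ G] in
theorem projG_apply (Z : E × V) : projG (E := E) ρ Z = Z.1 :=
  DFunLike.congr_fun (hasMFDerivAt_toG (E := E) (ρ := ρ) 1).mfderiv Z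

omit [LieGroup 𝓘(ℝ, E) ∞ G] in
theorem projV_apply (Z : E × V) : projV (E := E) ρ Z = Z.2 :=
  DFunLike.congr_fun (hasMFDerivAt_toV (E := E) (ρ := ρ) 1).mfderiv Z

omit [LieGroup 𝓘(ℝ, E) ∞ G] in
theorem dualPoint_apply (B : V →L[ℝ] V →L[ℝ] ℝ) (w : V) (α : E →L[ℝ] ℝ) (Z : E × V) :
    (dualPoint (E := E) ρ B w α : E × V →L[ℝ] ℝ) Z = α Z.1 + B w Z.2 := by
  rw [← projG_apply (ρ := ρ) Z, ← projV_apply (ρ := ρ) Z]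
  rfl

/-- The differential of the `V`-component of conjugation. -/
theorem projV_Ad (hρ : ContMDiff 𝓘(ℝ, E) 𝓘(ℝ, V →L[ℝ] V) ∞ ρ) (h : SemidirectGroup ρ)
    (Z : E × V) :
    projV (E := E) ρ (Ad (semidirectModel E V) h Z) =
      ρ h.1 Z.2 - ρ h.1 (infAct E ρ (ρ h.1⁻¹ h.2) Z.1) := by
  have : LieGroup (semidirectModel E V) ∞ (SemidirectGroup ρ) := SemidirectGroup.lieGroup ρ hρ
  have hc : ContMDiff (semidirectModel E V) (semidirectModel E V) ∞
      (fun k : SemidirectGroup ρ => h * k * h⁻¹) :=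
    contMDiff_mul_right.comp contMDiff_mul_left
  have h1 : HasMFDerivAt (semidirectModel E V) (semidirectModel E V)
      (fun k : SemidirectGroup ρ => h * k * h⁻¹) 1 (Ad (semidirectModel E V) h) :=
    ((hc 1).mdifferentiableAt (by simp)).hasMFDerivAt
  have h2 : HasMFDerivAt (semidirectModel E V) 𝓘(ℝ, V) (SemidirectGroup.toV ρ) (h * 1 * h⁻¹)
      (projV (E := E) ρ) := by
    rw [mul_one, mul_inv_cancel]
    exact (hasMFDerivAt_toV 1).mdifferentiableAt.hasMFDerivAt
  have h3 := h2.comp (1 : SemidirectGroup ρ) h1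
  have h4 : (SemidirectGroup.toV ρ ∘ fun k : SemidirectGroup ρ => h * k * h⁻¹) =
      fun k => (h.2 + ρ h.1 (SemidirectGroup.toV ρ k)) -
        ρ h.1 (ρ (SemidirectGroup.toG ρ k) (ρ h.1⁻¹ h.2)) := by
    funext k
    change h.2 + ρ h.1 k.2 + ρ (h.1 * k.1) (-ρ h.1⁻¹ h.2) = h.2 + ρ h.1 k.2 -
      ρ h.1 (ρ k.1 (ρ h.1⁻¹ h.2))
    rw [map_neg, rep_mul_apply, sub_eq_add_neg]
  have h5 : HasMFDerivAt (semidirectModel E V) 𝓘(ℝ, V)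
      (fun k : SemidirectGroup ρ => h.2 + ρ h.1 (SemidirectGroup.toV ρ k)) 1
      ((ρ h.1).comp (ContinuousLinearMap.snd ℝ E V)) := by
    have h6 : HasMFDerivAt 𝓘(ℝ, V) 𝓘(ℝ, V) (fun v => h.2 + ρ h.1 v)
        (SemidirectGroup.toV ρ 1) (ρ h.1) :=
      ((ρ h.1).hasFDerivAt.const_add h.2).hasMFDerivAt
    exact h6.comp (1 : SemidirectGroup ρ) (hasMFDerivAt_toV (E := E) (ρ := ρ) 1)
  have h7 : HasMFDerivAt (semidirectModel E V) 𝓘(ℝ, V)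
      (fun k : SemidirectGroup ρ => ρ h.1 (ρ (SemidirectGroup.toG ρ k) (ρ h.1⁻¹ h.2))) 1
      ((ρ h.1).comp ((infAct E ρ (ρ h.1⁻¹ h.2)).comp (ContinuousLinearMap.fst ℝ E V))) := by
    have h8 : HasMFDerivAt 𝓘(ℝ, E) 𝓘(ℝ, V) (fun g : G => ρ g (ρ h.1⁻¹ h.2))
        (SemidirectGroup.toG ρ 1) (infAct E ρ (ρ h.1⁻¹ h.2)) :=
      hasMFDerivAt_rep_apply hρ _
    have h9 := h8.comp (1 : SemidirectGroup ρ) (hasMFDerivAt_toG (E := E) (ρ := ρ) 1)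
    exact (ρ h.1).hasMFDerivAt.comp (1 : SemidirectGroup ρ) h9
  rw [h4] at h3
  exact DFunLike.congr_fun (h3.mfderiv.symm.trans (h5.sub h7).mfderiv) Z

end SemidirectAlgebra

/-! ### Invariant forms, the coadjoint orbit, and the bracket -/

section InnerAlgebra

variable {V : Type*} [NormedAddCommGroup V] [NormedSpace ℝ V] [FiniteDimensional ℝ V]
  {G : Type*} [Group G] {ρ : G →* (V →L[ℝ] V)} {B : V →L[ℝ] V →L[ℝ] ℝ}

/-- The isomorphism `V ≃ V*` defined by an invariant inner product. -/
def IsInvariantInner.toDual (hB : IsInvariantInner ρ B) : V ≃L[ℝ] (V →L[ℝ] ℝ) :=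
  (LinearEquiv.ofInjectiveOfFinrankEq (B : V →ₗ[ℝ] (V →L[ℝ] ℝ))
    (by
      rw [injective_iff_map_eq_zero]
      intro v hv
      by_contra hne
      have h := hB.pos v hne
      rw [show B v = 0 from hv] at h
      exact lt_irrefl 0 h)
    (by
      rw [(LinearMap.toContinuousLinearMap (𝕜 := ℝ) (E := V) (F' := ℝ)).symm.finrank_eq]
      exact (Subspace.dual_finrank_eq (K := ℝ) (V := V)).symm)).toContinuousLinearEquiv

theorem IsInvariantInner.apply_toDual_symm (hB : IsInvariantInner ρ B) (f : V →L[ℝ] ℝ) :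
    B (hB.toDual.symm f) = f := hB.toDual.apply_symm_apply f

theorem IsInvariantInner.toDual_symm_apply (hB : IsInvariantInner ρ B) (v : V) :
    hB.toDual.symm (B v) = v := hB.toDual.symm_apply_apply v

end InnerAlgebra

section SemidirectAlgebra

variable {E : Type*} [NormedAddCommGroup E] [NormedSpace ℝ E]
  {G : Type*} [Group G] [TopologicalSpace G] [ChartedSpace E G]
  {V : Type*} [NormedAddCommGroup V] [NormedSpace ℝ V]
  {ρ : G →* (V →L[ℝ] V)} {B : V →L[ℝ] V →L[ℝ] ℝ}

/-- The infinitesimal action is skew with respect to an invariant inner product. -/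
theorem inner_infAct (hρ : ContMDiff 𝓘(ℝ, E) 𝓘(ℝ, V →L[ℝ] V) ∞ ρ) (hB : IsInvariantInner ρ B)
    (w u : V) (X : E) : B w (infAct E ρ u X) = -B (infAct E ρ w X) u := by
  have h1 : HasMFDerivAt 𝓘(ℝ, E) 𝓘(ℝ, V →L[ℝ] V) ρ 1 (dRep E ρ) :=
    ((hρ 1).mdifferentiableAt (by simp)).hasMFDerivAt
  let ev : V → (V →L[ℝ] V) →L[ℝ] V := fun v => ContinuousLinearMap.apply ℝ V v
  have h2 : HasFDerivAt (fun T : V →L[ℝ] V => B (T w) (T u))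
      ((B.comp (ev w)).flip (ρ 1 u) + (B (ρ 1 w)).comp (ev u)) (ρ 1) := by
    have h3 := ((B.comp (ev w)).hasFDerivAt (x := ρ 1)).clm_apply ((ev u).hasFDerivAt (x := ρ 1))
    rw [add_comm] at h3
    exact h3
  have h4 := h2.hasMFDerivAt.comp (1 : G) h1
  -- Invariance makes this function constant on `G`, so its derivative at `1` vanishes.
  have h5 : ((fun T : V →L[ℝ] V => B (T w) (T u)) ∘ ρ) = fun _ : G => B w u :=
    funext fun g => hB.invariant g w u
  rw [h5] at h4
  have h6 := DFunLike.congr_fun (h4.mfderiv.symm.trans (hasMFDerivAt_const (B w u) (1 : G)).mfderiv) X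
  have h7 : B (dRep E ρ X w) (ρ 1 u) + B (ρ 1 w) (dRep E ρ X u) = 0 := h6
  rw [map_one] at h7
  have h8 : B (infAct E ρ w X) u + B w (infAct E ρ u X) = 0 := h7
  linarith

theorem momentMap_apply (hρ : ContMDiff 𝓘(ℝ, E) 𝓘(ℝ, V →L[ℝ] V) ∞ ρ) (w v : V) (X : E) :
    (momentMap (E := E) ρ B w v : E →L[ℝ] ℝ) X = B (infAct E ρ w X) v :=
  congrArg (fun y => B y v) (DFunLike.congr_fun (infRep_eq hρ w) X)

variable [LieGroup 𝓘(ℝ, E) ∞ G]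

/-- The coadjoint orbit of `x` is the union of the affine spaces `w + μ_w(V)`. -/
theorem mem_semidirectOrbit_iff (hρ : ContMDiff 𝓘(ℝ, E) 𝓘(ℝ, V →L[ℝ] V) ∞ ρ)
    (hB : IsInvariantInner ρ B) (x : V)
    (ξ : DualLieAlgebra (semidirectModel E V) (SemidirectGroup ρ)) :
    ξ ∈ semidirectOrbit E ρ B x ↔
      ∃ w ∈ repOrbit ρ x, ∃ v, ξ = dualPoint (E := E) ρ B w (momentMap ρ B w v) := by
  -- Using `k⁻¹` puts `Ad k` into the formula. As `x` has no `𝔤*` component, only the `V` component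
  -- of `Ad k` matters, and skewness of the infinitesimal action turns its translation term into the
  -- moment map.
  have key : ∀ k : SemidirectGroup ρ, coAd (semidirectModel E V) k⁻¹ (dualPoint (E := E) ρ B x 0) =
      dualPoint (E := E) ρ B (ρ k.1⁻¹ x) (momentMap ρ B (ρ k.1⁻¹ x) (ρ k.1⁻¹ k.2)) := by
    intro k
    refine ContinuousLinearMap.ext fun Z : E × V => ?_
    have h1 : coAd (semidirectModel E V) k⁻¹ (dualPoint (E := E) ρ B x 0) Z =
        B x (projV (E := E) ρ (Ad (semidirectModel E V) k Z)) := by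
      have h2 : coAd (semidirectModel E V) k⁻¹ (dualPoint (E := E) ρ B x 0) Z =
        (0 : ℝ) + B x (projV (E := E) ρ (Ad (semidirectModel E V) (k⁻¹)⁻¹ Z)) := rfl
      rw [h2, inv_inv, zero_add]
    have hinv : ∀ y, B x (ρ k.1 y) = B (ρ k.1⁻¹ x) y := fun y => by
      rw [← hB.invariant k.1 (ρ k.1⁻¹ x) y, rep_apply_inv]
    have h3 : dualPoint (E := E) ρ B (ρ k.1⁻¹ x)
        (momentMap ρ B (ρ k.1⁻¹ x) (ρ k.1⁻¹ k.2)) Z =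
        B (infAct E ρ (ρ k.1⁻¹ x) Z.1) (ρ k.1⁻¹ k.2) + B (ρ k.1⁻¹ x) Z.2 :=
      (dualPoint_apply (E := E) (ρ := ρ) B (ρ k.1⁻¹ x) _ Z).trans
        (congrArg (fun r => r + B (ρ k.1⁻¹ x) Z.2) (momentMap_apply hρ _ _ _))
    refine (h1.trans ?_).trans h3.symm
    rw [projV_Ad hρ, map_sub, hinv, hinv, inner_infAct hρ hB]
    ring
  constructor
  · rintro ⟨h, rfl⟩
    have := key h⁻¹
    rw [inv_inv] at this
    exact ⟨_, ⟨_, rfl⟩, _, this⟩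
  · rintro ⟨_, ⟨g, rfl⟩, v, rfl⟩
    -- Chosen so that `ρ(k.1⁻¹) x = ρ(g) x` and `ρ(k.1⁻¹) k.2 = v`.
    let k : SemidirectGroup ρ := (g⁻¹, ρ g⁻¹ v)
    refine ⟨k⁻¹, (key k).trans ?_⟩
    change dualPoint (E := E) ρ B (ρ g⁻¹⁻¹ x) (momentMap ρ B (ρ g⁻¹⁻¹ x) (ρ g⁻¹⁻¹ (ρ g⁻¹ v))) = _
    rw [inv_inv, rep_apply_inv]

/-- The linear part of the affine representation of `G ×_ρ V` on `V × ℝ`. -/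
def affineRepPart (V : Type*) [NormedAddCommGroup V] [NormedSpace ℝ V] :
    ((V →L[ℝ] V) × V) →L[ℝ] (V × ℝ →L[ℝ] V × ℝ) :=
  (ContinuousLinearMap.compL ℝ (V × ℝ) V (V × ℝ) (ContinuousLinearMap.inl ℝ V ℝ)).comp
    (((ContinuousLinearMap.compL ℝ (V × ℝ) V V).flip (ContinuousLinearMap.fst ℝ V ℝ)).comp
        (ContinuousLinearMap.fst ℝ (V →L[ℝ] V) V) +
      (ContinuousLinearMap.smulRightL ℝ (V × ℝ) V (ContinuousLinearMap.snd ℝ V ℝ)).comp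
        (ContinuousLinearMap.snd ℝ (V →L[ℝ] V) V))

/-- The representation `(g, v) ↦ ((w, s) ↦ (ρ(g) w + s v, s))` of `G ×_ρ V` on `V × ℝ`. -/
def affineRep (ρ : G →* (V →L[ℝ] V)) : SemidirectGroup ρ →* (V × ℝ →L[ℝ] V × ℝ) where
  toFun a := affineRepPart V (ρ a.1, a.2) +
    (ContinuousLinearMap.inr ℝ V ℝ).comp (ContinuousLinearMap.snd ℝ V ℝ)
  map_one' := by
    refine ContinuousLinearMap.ext fun y => ?_
    change (ρ 1 y.1 + y.2 • (0 : V), (0 : ℝ)) + ((0 : V), y.2) = y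
    rw [map_one]
    simp
  map_mul' a b := by
    refine ContinuousLinearMap.ext fun y => ?_
    change (ρ (a.1 * b.1) y.1 + y.2 • (a.2 + ρ a.1 b.2), (0 : ℝ)) + ((0 : V), y.2) =
      (ρ a.1 (ρ b.1 y.1 + y.2 • b.2 + 0) + (0 + y.2) • a.2, (0 : ℝ)) + ((0 : V), 0 + y.2)
    simp only [rep_mul_apply, smul_add, map_add, map_smul, Prod.mk_add_mk, add_zero, zero_add]
    refine Prod.ext ?_ rfl
    simp only
    abel

variable [FiniteDimensional ℝ E] [FiniteDimensional ℝ V]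

/-- The bracket of `𝔤_ρ`, as far as it is visible in `V`. -/
theorem semidirect_bracket (hρ : ContMDiff 𝓘(ℝ, E) 𝓘(ℝ, V →L[ℝ] V) ∞ ρ)
    (X Y : GroupLieAlgebra (semidirectModel E V) (SemidirectGroup ρ)) (Z X' Y' : E × V)
    (hX : X = X') (hY : Y = Y')
    (hZ : (⁅X, Y⁆ : GroupLieAlgebra (semidirectModel E V) (SemidirectGroup ρ)) = Z) :
    Z.2 = infAct E ρ Y'.2 X'.1 - infAct E ρ X'.2 Y'.1 ∧
    ∀ w, infAct E ρ w Z.1 =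
      infAct E ρ (infAct E ρ w Y'.1) X'.1 - infAct E ρ (infAct E ρ w X'.1) Y'.1 := by
  have : LieGroup (semidirectModel E V) ∞ (SemidirectGroup ρ) := SemidirectGroup.lieGroup ρ hρ
  have : CompleteSpace (E × V) := FiniteDimensional.complete ℝ (E × V)
  have htoG : ContMDiff (semidirectModel E V) 𝓘(ℝ, E) ∞ (SemidirectGroup.toG ρ) :=
    contMDiff_fst (I := 𝓘(ℝ, E)) (J := 𝓘(ℝ, V)) (M := G) (N := V)
  have htoV : ContMDiff (semidirectModel E V) 𝓘(ℝ, V) ∞ (SemidirectGroup.toV ρ) :=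
    contMDiff_snd (I := 𝓘(ℝ, E)) (J := 𝓘(ℝ, V)) (M := G) (N := V)
  let C : V × ℝ →L[ℝ] V × ℝ :=
    (ContinuousLinearMap.inr ℝ V ℝ).comp (ContinuousLinearMap.snd ℝ V ℝ)
  have hΨ : ContDiff ℝ ∞ (fun p : (V →L[ℝ] V) × V => affineRepPart V p + C) :=
    (affineRepPart V).contDiff.add contDiff_const
  have hR : ContMDiff (semidirectModel E V) 𝓘(ℝ, V × ℝ →L[ℝ] V × ℝ) ∞ (affineRep ρ) :=
    hΨ.contMDiff.comp ((hρ.comp htoG).prodMk_space htoV)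
  let D₀ : E × V →L[ℝ] (V →L[ℝ] V) × V :=
    ((dRep E ρ).comp (ContinuousLinearMap.fst ℝ E V)).prod (ContinuousLinearMap.snd ℝ E V)
  let D : E × V →L[ℝ] (V × ℝ →L[ℝ] V × ℝ) := (affineRepPart V).comp D₀
  have hD : HasMFDerivAt (semidirectModel E V) 𝓘(ℝ, V × ℝ →L[ℝ] V × ℝ) (affineRep ρ) 1 D := by
    have h1 : HasMFDerivAt 𝓘(ℝ, E) 𝓘(ℝ, V →L[ℝ] V) ρ (SemidirectGroup.toG ρ 1) (dRep E ρ) :=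
      ((hρ 1).mdifferentiableAt (by simp)).hasMFDerivAt
    have h2 := h1.comp (1 : SemidirectGroup ρ) (hasMFDerivAt_toG (E := E) (ρ := ρ) 1)
    let f : SemidirectGroup ρ → (V →L[ℝ] V) × V := fun a =>
      (ρ (SemidirectGroup.toG ρ a), SemidirectGroup.toV ρ a)
    have h3 : HasMFDerivAt (semidirectModel E V) 𝓘(ℝ, (V →L[ℝ] V) × V) f 1 D₀ := by
      have h5 := (ContinuousLinearMap.inl ℝ (V →L[ℝ] V) V).hasMFDerivAt.comp
        (1 : SemidirectGroup ρ) h2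
      have h6 := (ContinuousLinearMap.inr ℝ (V →L[ℝ] V) V).hasMFDerivAt.comp
        (1 : SemidirectGroup ρ) (hasMFDerivAt_toV (E := E) (ρ := ρ) 1)
      have h7 : ∀ a, f a = ContinuousLinearMap.inl ℝ (V →L[ℝ] V) V (ρ (SemidirectGroup.toG ρ a)) +
          ContinuousLinearMap.inr ℝ (V →L[ℝ] V) V (SemidirectGroup.toV ρ a) := fun a => by simp [f]
      have h8 : D₀ = (ContinuousLinearMap.inl ℝ (V →L[ℝ] V) V).comp
            ((dRep E ρ).comp (ContinuousLinearMap.fst ℝ E V)) +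
          (ContinuousLinearMap.inr ℝ (V →L[ℝ] V) V).comp (ContinuousLinearMap.snd ℝ E V) :=
        ContinuousLinearMap.ext fun Z => by simp [D₀]
      rw [funext h7, h8]
      exact h5.add h6
    have h4 : HasMFDerivAt 𝓘(ℝ, (V →L[ℝ] V) × V) 𝓘(ℝ, V × ℝ →L[ℝ] V × ℝ)
        (fun p : (V →L[ℝ] V) × V => affineRepPart V p + C)
        (f 1) (affineRepPart V) :=
      ((affineRepPart V).hasFDerivAt.add_const C).hasMFDerivAt
    exact h4.comp (1 : SemidirectGroup ρ) h3
  -- The commutator in the affine representation is evaluated on `(0, 1)`, which reveals the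
  -- `V`-part of the bracket, and on `(w, 0)`, which reveals the action of its `𝔤`-part. That action
  -- suffices even when `ρ` is not faithful, since points of the orbit see `𝔤` only through it.
  have key := mfderiv_rep_bracket hR D hD X Y
  rw [hZ, hX, hY] at key
  have hDap : ∀ (Z : E × V) (y : V × ℝ), D Z y = (infAct E ρ y.1 Z.1 + y.2 • Z.2, 0) :=
    fun Z y => rfl
  have key' : ∀ y, D Z y = D X' (D Y' y) - D Y' (D X' y) := fun y => DFunLike.congr_fun key y
  constructor
  · have h := congrArg Prod.fst (key' (0, 1))
    simpa [hDap] using h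
  · intro w
    have h := congrArg Prod.fst (key' (w, 0))
    simpa [hDap] using h

end SemidirectAlgebra

/-! ### Cotangent coordinates on the coadjoint orbit -/

/-- Change of the parameter space of a graph chart. -/
def GraphChart.reparam {A A' : Type*} [NormedAddCommGroup A] [NormedSpace ℝ A]
    [NormedAddCommGroup A'] [NormedSpace ℝ A'] {W : Type*} [NormedAddCommGroup W]
    [NormedSpace ℝ W] {S : Set W} (c : GraphChart A S) (K : A ≃L[ℝ] A') : GraphChart A' S where
  dom := c.dom
  param := K.symm ⁻¹' c.param
  proj := (K : A →L[ℝ] A').comp c.proj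
  sec t := c.sec (K.symm t)
  isOpen_dom := c.isOpen_dom
  isOpen_param := c.isOpen_param.preimage K.symm.continuous
  contDiffOn_sec := c.contDiffOn_sec.comp K.symm.contDiff.contDiffOn fun _ ht => ht
  sec_mem _ ht := c.sec_mem _ ht
  sec_mem_dom _ ht := c.sec_mem_dom _ ht
  proj_sec t ht := by simp [c.proj_sec _ ht]
  proj_mem s hs hs' := by simpa using c.proj_mem s hs hs'
  sec_proj s hs hs' := by simpa using c.sec_proj s hs hs'

section FiberPoint

variable {E : Type*} [NormedAddCommGroup E] [NormedSpace ℝ E]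
  {G : Type*} [Group G] [TopologicalSpace G] [ChartedSpace E G]
  {V : Type*} [NormedAddCommGroup V] [NormedSpace ℝ V]
  {ρ : G →* (V →L[ℝ] V)} {B : V →L[ℝ] V →L[ℝ] ℝ}
  {A : Type*} [NormedAddCommGroup A] [NormedSpace ℝ A] {x : V}

variable (E B) in
/-- The point of the coadjoint orbit with cotangent coordinates `(t, q)`, with respect to a
parametrization of the orbit of `x`. -/
def fiberPoint (c : GraphChart A (repOrbit ρ x)) (y : A × (A →L[ℝ] ℝ)) : E × V →L[ℝ] ℝ :=
  (y.2.comp (c.proj.comp (infAct E ρ (c.sec y.1)))).comp (ContinuousLinearMap.fst ℝ E V) +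
    (B (c.sec y.1)).comp (ContinuousLinearMap.snd ℝ E V)

theorem fiberPoint_apply (c : GraphChart A (repOrbit ρ x)) (y : A × (A →L[ℝ] ℝ)) (Z : E × V) :
    fiberPoint E B c y Z =
      y.2 (c.proj (infAct E ρ (c.sec y.1) Z.1)) + B (c.sec y.1) Z.2 := rfl

theorem contDiffOn_fiberPoint (c : GraphChart A (repOrbit ρ x)) :
    ContDiffOn ℝ ∞ (fiberPoint E B c) (c.param ×ˢ Set.univ) := by
  have hsec : ContDiffOn ℝ ∞ (fun y : A × (A →L[ℝ] ℝ) => c.sec y.1) (c.param ×ˢ Set.univ) :=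
    c.contDiffOn_sec.comp contDiff_fst.contDiffOn fun y hy => hy.1
  have h1 : ContDiffOn ℝ ∞ (fun y : A × (A →L[ℝ] ℝ) => infAct E ρ (c.sec y.1))
      (c.param ×ˢ Set.univ) := (infAct E ρ).contDiff.comp_contDiffOn hsec
  have h2 : ContDiffOn ℝ ∞ (fun y : A × (A →L[ℝ] ℝ) => B (c.sec y.1))
      (c.param ×ˢ Set.univ) := B.contDiff.comp_contDiffOn hsec
  exact ((contDiff_snd.contDiffOn.clm_comp (contDiffOn_const.clm_comp h1)).clm_comp
    contDiffOn_const).add (h2.clm_comp contDiffOn_const)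

theorem hasFDerivAt_fiberPoint (c : GraphChart A (repOrbit ρ x)) {y : A × (A →L[ℝ] ℝ)}
    (hy : y.1 ∈ c.param) :
    HasFDerivAt (fiberPoint E B c) (fderiv ℝ (fiberPoint E B c) y) y :=
  ((contDiffOn_fiberPoint (E := E) (B := B) c).contDiffAt ((c.isOpen_param.prod isOpen_univ).mem_nhds
    ⟨hy, trivial⟩)).differentiableAt (by simp) |>.hasFDerivAt

/-- The product rule: at a fixed `Z` the functional is bilinear in the covector and `c.sec` plus a
term linear in `c.sec`. -/
theorem fderiv_fiberPoint_apply (c : GraphChart A (repOrbit ρ x)) {y : A × (A →L[ℝ] ℝ)}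
    (hy : y.1 ∈ c.param) (a : A × (A →L[ℝ] ℝ)) (Z : E × V) :
    fderiv ℝ (fiberPoint E B c) y a Z =
      a.2 (c.proj (infAct E ρ (c.sec y.1) Z.1)) +
        y.2 (c.proj (infAct E ρ (fderiv ℝ c.sec y.1 a.1) Z.1)) +
      B (fderiv ℝ c.sec y.1 a.1) Z.2 := by
  have h1 := (hasFDerivAt_fiberPoint (E := E) (B := B) c hy).clm_apply (hasFDerivAt_const Z y)
  have hs : HasFDerivAt (fun y : A × (A →L[ℝ] ℝ) => c.sec y.1)
      ((fderiv ℝ c.sec y.1).comp (ContinuousLinearMap.fst ℝ A (A →L[ℝ] ℝ))) y :=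
    (c.hasFDerivAt_sec hy).comp y hasFDerivAt_fst
  let K : V →L[ℝ] A := c.proj.comp ((infAct E ρ).flip Z.1)
  have h2 := ((hasFDerivAt_snd (p := y)).clm_apply (K.hasFDerivAt.comp y hs)).add
    ((B.flip Z.2).hasFDerivAt.comp y hs)
  have h3 := DFunLike.congr_fun (h1.unique h2) a
  simp only [add_apply, ContinuousLinearMap.comp_apply,
    ContinuousLinearMap.flip_apply, zero_apply, map_zero, zero_add,
    ContinuousLinearMap.coe_fst', ContinuousLinearMap.coe_snd', K] at h3
  rw [h3]
  simp only [Function.comp_apply, ContinuousLinearMap.comp_apply, ContinuousLinearMap.flip_apply]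
  ring

variable [FiniteDimensional ℝ V]

/-- The point `w ∈ V` of the functional `w + α`. -/
def IsInvariantInner.basePoint (E : Type*) [NormedAddCommGroup E] [NormedSpace ℝ E]
    (hB : IsInvariantInner ρ B) : (E × V →L[ℝ] ℝ) →L[ℝ] V :=
  (hB.toDual.symm : (V →L[ℝ] ℝ) →L[ℝ] V).comp
    ((ContinuousLinearMap.compL ℝ V (E × V) ℝ).flip (ContinuousLinearMap.inr ℝ E V))

omit [TopologicalSpace G] [ChartedSpace E G] in
theorem IsInvariantInner.basePoint_eq (hB : IsInvariantInner ρ B) {ξ : E × V →L[ℝ] ℝ} {w : V}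
    (h : ∀ u, ξ (0, u) = B w u) : hB.basePoint E ξ = w := by
  change hB.toDual.symm (ξ.comp (ContinuousLinearMap.inr ℝ E V)) = w
  rw [show ξ.comp (ContinuousLinearMap.inr ℝ E V) = B w from ContinuousLinearMap.ext h,
    hB.toDual_symm_apply]

theorem basePoint_dualPoint (hB : IsInvariantInner ρ B) (w : V) (α : E →L[ℝ] ℝ) :
    hB.basePoint E (dualPoint (E := E) ρ B w α) = w :=
  hB.basePoint_eq fun u => by rw [dualPoint_apply]; simp

theorem basePoint_fiberPoint (hB : IsInvariantInner ρ B) (c : GraphChart A (repOrbit ρ x))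
    (y : A × (A →L[ℝ] ℝ)) : hB.basePoint E (fiberPoint E B c y) = c.sec y.1 :=
  hB.basePoint_eq fun u => by rw [fiberPoint_apply]; simp

/-- The covector `q` extends to `V` as `q ∘ proj`, and the inner product represents this extension
by a vector `v`. -/
theorem fiberPoint_eq_dualPoint (hρ : ContMDiff 𝓘(ℝ, E) 𝓘(ℝ, V →L[ℝ] V) ∞ ρ)
    (hB : IsInvariantInner ρ B) (c : GraphChart A (repOrbit ρ x)) (y : A × (A →L[ℝ] ℝ)) :
    fiberPoint E B c y = dualPoint (E := E) ρ B (c.sec y.1)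
      (momentMap ρ B (c.sec y.1) (hB.toDual.symm (y.2.comp c.proj))) := by
  refine ContinuousLinearMap.ext fun Z => ?_
  refine Eq.trans ?_ (dualPoint_apply (E := E) (ρ := ρ) B (c.sec y.1) _ Z).symm
  refine congrArg (fun r => r + B (c.sec y.1) Z.2) ?_
  refine Eq.trans ?_ (momentMap_apply hρ _ _ _).symm
  rw [hB.symm, hB.apply_toDual_symm]
  rfl

variable [LieGroup 𝓘(ℝ, E) ∞ G]

theorem fiberPoint_mem (hρ : ContMDiff 𝓘(ℝ, E) 𝓘(ℝ, V →L[ℝ] V) ∞ ρ)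
    (hB : IsInvariantInner ρ B) (c : GraphChart A (repOrbit ρ x)) {y : A × (A →L[ℝ] ℝ)}
    (hy : y.1 ∈ c.param) : fiberPoint E B c y ∈ semidirectOrbit E ρ B x :=
  (mem_semidirectOrbit_iff hρ hB x _).2
    ⟨_, c.sec_mem _ hy, _, fiberPoint_eq_dualPoint hρ hB c y⟩

-- Since each `ρ(X) w` is tangent to the orbit, `v` matters only through its pairing with the range
-- of `D sec`; this pairing is the covector coordinate.
omit [FiniteDimensional ℝ V] in
theorem dualPoint_momentMap_eq_fiberPoint (hρ : ContMDiff 𝓘(ℝ, E) 𝓘(ℝ, V →L[ℝ] V) ∞ ρ)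
    (hB : IsInvariantInner ρ B) (c : GraphChart A (repOrbit ρ x)) {w : V}
    (hw : w ∈ repOrbit ρ x) (hwc : w ∈ c.dom) (v : V) :
    (dualPoint (E := E) ρ B w (momentMap ρ B w v) : E × V →L[ℝ] ℝ) =
      fiberPoint E B c (c.proj w, (B v).comp (fderiv ℝ c.sec (c.proj w))) := by
  refine ContinuousLinearMap.ext fun Z => ?_
  refine (dualPoint_apply (E := E) (ρ := ρ) B w _ Z).trans ?_
  rw [fiberPoint_apply, c.sec_proj w hw hwc]
  refine congrArg (fun r => r + B w Z.2) ?_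
  refine (momentMap_apply hρ _ _ _).trans ?_
  rw [hB.symm]
  exact congrArg (B v) (DFunLike.congr_fun (infAct_eq_fderiv_sec hρ c hw hwc) Z.1)

variable [FiniteDimensional ℝ E] [FiniteDimensional ℝ A]

/-- Tangent vectors of the coadjoint orbit, in cotangent coordinates, are of the form
`ad*(X) ξ`. -/
theorem exists_isCoad_fiberPoint (hρ : ContMDiff 𝓘(ℝ, E) 𝓘(ℝ, V →L[ℝ] V) ∞ ρ)
    (hB : IsInvariantInner ρ B)
    (hA : Module.finrank ℝ (LinearMap.range (infAct E ρ x : E →ₗ[ℝ] V)) = Module.finrank ℝ A)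
    (c : GraphChart A (repOrbit ρ x)) {y : A × (A →L[ℝ] ℝ)} (hy : y.1 ∈ c.param)
    (a : A × (A →L[ℝ] ℝ)) :
    ∃ X : E × V, IsCoad (J := semidirectModel E V) (L := SemidirectGroup ρ) X
        (fiberPoint E B c y) (fderiv ℝ (fiberPoint E B c) y a) ∧
      infAct E ρ (c.sec y.1) X.1 = fderiv ℝ c.sec y.1 a.1 ∧
      ∀ v, B X.2 v = -(a.2 (c.proj v) + y.2 (c.proj (infAct E ρ v X.1))) := by
  have hw := c.sec_mem _ hy
  have hwc := c.sec_mem_dom _ hy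
  obtain ⟨X₁, hX₁⟩ := proj_infAct_surjective hρ hA c hw hwc a.1
  have hX₁' : infAct E ρ (c.sec y.1) X₁ = fderiv ℝ c.sec y.1 a.1 := by
    have h := DFunLike.congr_fun (infAct_eq_fderiv_sec hρ c hw hwc) X₁
    rw [ContinuousLinearMap.comp_apply, hX₁, c.proj_sec _ hy] at h
    exact h
  -- `X₁` already accounts for the motion of the base point. Comparing the remaining terms of
  -- `ad*(X) ξ` with the prescribed derivative leaves a linear condition on the `V`-part of `X`,
  -- tested on the vectors `ρ(Z) w`; imposing it on all of `V` determines that part by duality.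
  let f : V →L[ℝ] ℝ :=
    -(a.2.comp c.proj + y.2.comp (c.proj.comp ((infAct E ρ).flip X₁)))
  have hu : ∀ v, B (hB.toDual.symm f) v =
      -(a.2 (c.proj v) + y.2 (c.proj (infAct E ρ v X₁))) := fun v => by
    rw [hB.apply_toDual_symm]
    rfl
  suffices ∀ X : GroupLieAlgebra (semidirectModel E V) (SemidirectGroup ρ),
      X = ((X₁, hB.toDual.symm f) : E × V) → IsCoad X
        (fiberPoint E B c y) (fderiv ℝ (fiberPoint E B c) y a) from
    ⟨(X₁, hB.toDual.symm f), this _ rfl, hX₁', hu⟩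
  intro X hX Z
  obtain ⟨Z', hZ'⟩ : ∃ Z' : E × V, Z = Z' := ⟨Z, rfl⟩
  obtain ⟨N, hN⟩ : ∃ N : E × V,
      (⁅X, Z⁆ : GroupLieAlgebra (semidirectModel E V) (SemidirectGroup ρ)) = N := ⟨_, rfl⟩
  obtain ⟨h1, h2⟩ := semidirect_bracket hρ X Z N (X₁, hB.toDual.symm f) Z' hX hZ' hN
  rw [hN, hZ']
  change fderiv ℝ (fiberPoint E B c) y a Z' = -fiberPoint E B c y N
  rw [fderiv_fiberPoint_apply c hy, fiberPoint_apply, h1, h2, ← hX₁']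
  simp only [map_sub]
  rw [inner_infAct hρ hB _ Z'.2 X₁, inner_infAct hρ hB _ _ Z'.1, hB.symm _ (hB.toDual.symm f), hu]
  ring

/-- The Kostant–Kirillov–Souriau form in cotangent coordinates. -/
theorem fiberPoint_bracket (hρ : ContMDiff 𝓘(ℝ, E) 𝓘(ℝ, V →L[ℝ] V) ∞ ρ)
    (hB : IsInvariantInner ρ B)
    (hA : Module.finrank ℝ (LinearMap.range (infAct E ρ x : E →ₗ[ℝ] V)) = Module.finrank ℝ A)
    (c : GraphChart A (repOrbit ρ x)) {y : A × (A →L[ℝ] ℝ)} (hy : y.1 ∈ c.param)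
    (a b : A × (A →L[ℝ] ℝ)) :
    ∃ X Y : GroupLieAlgebra (semidirectModel E V) (SemidirectGroup ρ),
      IsCoad X (fiberPoint E B c y) (fderiv ℝ (fiberPoint E B c) y a) ∧
      IsCoad Y (fiberPoint E B c y) (fderiv ℝ (fiberPoint E B c) y b) ∧
      fiberPoint E B c y (⁅X, Y⁆ : GroupLieAlgebra (semidirectModel E V) (SemidirectGroup ρ)) =
        b.2 a.1 - a.2 b.1 := by
  obtain ⟨X, hX, hXa, -⟩ := exists_isCoad_fiberPoint hρ hB hA c hy a
  obtain ⟨Y, hY, hYb, hYB⟩ := exists_isCoad_fiberPoint hρ hB hA c hy b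
  refine ⟨X, Y, hX, hY, ?_⟩
  -- The condition defining the `V`-part of `Y`, applied to `D sec a₁`, cancels the term in which
  -- `Y` acts on `D sec a₁`.
  have h1 : fderiv ℝ (fiberPoint E B c) y a Y = -fiberPoint E B c y _ := hX Y
  rw [fderiv_fiberPoint_apply c hy, hB.symm _ Y.2, hYB, hYb] at h1
  have h2 : ∀ d, c.proj (fderiv ℝ c.sec y.1 d) = d :=
    fun d => DFunLike.congr_fun (c.proj_comp_fderiv_sec hy) d
  rw [h2, h2] at h1
  linarith

omit [FiniteDimensional ℝ E] in
/-- The coadjoint orbit is a graph near each fibre. -/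
theorem exists_graphChart_prod_semidirectOrbit (hρ : ContMDiff 𝓘(ℝ, E) 𝓘(ℝ, V →L[ℝ] V) ∞ ρ)
    (hB : IsInvariantInner ρ B)
    (hA : Module.finrank ℝ (LinearMap.range (infAct E ρ x : E →ₗ[ℝ] V)) = Module.finrank ℝ A)
    (c : GraphChart A (repOrbit ρ x)) {w : V} (hw : w ∈ repOrbit ρ x) (hwc : w ∈ c.dom) :
    ∃ (d : GraphChart (A × (A →L[ℝ] ℝ)) (semidirectOrbit E ρ B x))
      (τ : A × (A →L[ℝ] ℝ) → A × (A →L[ℝ] ℝ)),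
      ContDiffOn ℝ ∞ τ d.param ∧
      (∀ y ∈ d.param, (τ y).1 ∈ c.param ∧ d.sec y = fiberPoint E B c (τ y)) ∧
      ∀ α : E →L[ℝ] ℝ, dualPoint (E := E) ρ B w α ∈ d.dom := by
  have : CompleteSpace A := FiniteDimensional.complete ℝ A
  -- The covector `q` is not a linear function of `ξ`, because `ξ(X, 0) = q(proj (ρ(X) w'))`
  -- involves the moving base point `w'`. Fixing a section `σ` at `w` replaces `q` by `q ∘ T t`,
  -- which is linear in `ξ`; `T` is the identity at `w`, hence invertible nearby, and `τ` undoes the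
  -- twist.
  obtain ⟨σ, hσ⟩ := (c.proj.comp (infAct E ρ w)).exists_rightInverse_of_surjective
    (LinearMap.range_eq_top.2 (proj_infAct_surjective hρ hA c hw hwc))
  let T : A → A →L[ℝ] A := fun t => (c.proj.comp (infAct E ρ (c.sec t))).comp σ
  have hT : ContDiffOn ℝ ∞ T c.param :=
    (contDiffOn_const.clm_comp
      ((infAct E ρ).contDiff.comp_contDiffOn c.contDiffOn_sec)).clm_comp contDiffOn_const
  let D : Set A := c.param ∩ T ⁻¹' Set.range ((↑) : (A ≃L[ℝ] A) → A →L[ℝ] A)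
  have hD : IsOpen D :=
    hT.continuousOn.isOpen_inter_preimage c.isOpen_param ContinuousLinearEquiv.isOpen
  have hinv : ∀ t ∈ D, (T t).comp (T t).inverse = ContinuousLinearMap.id ℝ A ∧
      (T t).inverse.comp (T t) = ContinuousLinearMap.id ℝ A := by
    rintro t ⟨-, e, he⟩
    rw [← he, ContinuousLinearMap.inverse_equiv]
    exact ⟨e.coe_comp_coe_symm, e.coe_symm_comp_coe⟩
  have hTinv : ContDiffOn ℝ ∞ (fun t => (T t).inverse) D := by
    rintro t ⟨ht, e, he⟩
    have h1 : ContDiffAt ℝ ∞ ContinuousLinearMap.inverse (T t) := he ▸ contDiffAt_map_inverse e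
    exact (h1.comp t (hT.contDiffAt (c.isOpen_param.mem_nhds ht))).contDiffWithinAt
  let τ : A × (A →L[ℝ] ℝ) → A × (A →L[ℝ] ℝ) := fun y => (y.1, y.2.comp (T y.1).inverse)
  have hτ : ContDiffOn ℝ ∞ τ (D ×ˢ Set.univ) :=
    contDiff_fst.contDiffOn.prodMk (contDiff_snd.contDiffOn.clm_comp
      (hTinv.comp contDiff_fst.contDiffOn fun y hy => hy.1))
  let b := hB.basePoint E
  let pr : (E × V →L[ℝ] ℝ) →L[ℝ] A × (A →L[ℝ] ℝ) :=
    (c.proj.comp b).prod ((ContinuousLinearMap.compL ℝ A (E × V) ℝ).flip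
      ((ContinuousLinearMap.inl ℝ E V).comp σ))
  have hpr : ∀ y : A × (A →L[ℝ] ℝ), y.1 ∈ c.param →
      pr (fiberPoint E B c y) = (y.1, y.2.comp (T y.1)) := by
    intro y hy
    refine Prod.ext ?_ (ContinuousLinearMap.ext fun a => ?_)
    · change c.proj (hB.basePoint E (fiberPoint E B c y)) = y.1
      rw [basePoint_fiberPoint, c.proj_sec _ hy]
    · change fiberPoint E B c y (σ a, 0) = y.2 (T y.1 a)
      rw [fiberPoint_apply, map_zero, add_zero]
      rfl
  have hsurj : ∀ s ∈ semidirectOrbit E ρ B x, b s ∈ c.dom → ∃ y : A × (A →L[ℝ] ℝ),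
      y.1 ∈ c.param ∧ y.1 = c.proj (b s) ∧ s = fiberPoint E B c y := by
    intro s hs hsd
    obtain ⟨w', hw', v, rfl⟩ := (mem_semidirectOrbit_iff hρ hB x s).1 hs
    have hb : b (dualPoint (E := E) ρ B w' (momentMap ρ B w' v)) = w' :=
      basePoint_dualPoint hB w' _
    rw [hb] at hsd
    exact ⟨_, c.proj_mem _ hw' hsd, by rw [hb],
      dualPoint_momentMap_eq_fiberPoint hρ hB c hw' hsd v⟩
  refine ⟨
    { dom := b ⁻¹' (c.dom ∩ c.proj ⁻¹' D)
      param := D ×ˢ Set.univ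
      proj := pr
      sec := fun y => fiberPoint E B c (τ y)
      isOpen_dom := (c.isOpen_dom.inter (hD.preimage c.proj.continuous)).preimage b.continuous
      isOpen_param := hD.prod isOpen_univ
      contDiffOn_sec := (contDiffOn_fiberPoint c).comp hτ fun y hy => ⟨hy.1.1, trivial⟩
      sec_mem := fun y hy => fiberPoint_mem hρ hB c hy.1.1
      sec_mem_dom := fun y hy => ?_
      proj_sec := fun y hy => ?_
      proj_mem := fun s _ hs' => ⟨hs'.2, trivial⟩
      sec_proj := fun s hs hs' => ?_ }, τ, hτ, fun y hy => ⟨hy.1.1, rfl⟩, fun α => ?_⟩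
  · have h : b (fiberPoint E B c (τ y)) = c.sec y.1 := basePoint_fiberPoint hB c (τ y)
    rw [Set.mem_preimage, h]
    refine ⟨c.sec_mem_dom _ hy.1.1, ?_⟩
    rw [Set.mem_preimage, c.proj_sec _ hy.1.1]
    exact hy.1
  · rw [hpr (τ y) hy.1.1]
    refine Prod.ext rfl ?_
    change (y.2.comp (T y.1).inverse).comp (T y.1) = y.2
    rw [ContinuousLinearMap.comp_assoc, (hinv y.1 hy.1).2, ContinuousLinearMap.comp_id]
  · obtain ⟨y, hy, hyb, rfl⟩ := hsurj s hs hs'.1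
    rw [hpr y hy]
    have hyD : y.1 ∈ D := hyb ▸ hs'.2
    change fiberPoint E B c (y.1, (y.2.comp (T y.1)).comp (T y.1).inverse) = fiberPoint E B c y
    rw [ContinuousLinearMap.comp_assoc, (hinv y.1 hyD).1, ContinuousLinearMap.comp_id]
  -- The domain restricts the base point only, so it contains the entire fibre over `w`.
  · have h : b (dualPoint (E := E) ρ B w α) = w := basePoint_dualPoint hB w α
    change b (dualPoint (E := E) ρ B w α) ∈ c.dom ∩ c.proj ⁻¹' D
    rw [h]
    refine ⟨hwc, c.proj_mem w hw hwc, ContinuousLinearEquiv.refl ℝ A, ?_⟩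
    change _ = (c.proj.comp (infAct E ρ (c.sec (c.proj w)))).comp σ
    rw [c.sec_proj w hw hwc, hσ]
    rfl

omit [FiniteDimensional ℝ E] in
/-- The coadjoint orbit is a graph near each fibre, with cotangent coordinates depending smoothly
on the parameter of the graph. -/
theorem exists_graphChart_semidirectOrbit (hρ : ContMDiff 𝓘(ℝ, E) 𝓘(ℝ, V →L[ℝ] V) ∞ ρ)
    (hB : IsInvariantInner ρ B)
    (hA : Module.finrank ℝ (LinearMap.range (infAct E ρ x : E →ₗ[ℝ] V)) = Module.finrank ℝ A)
    {A' : Type*} [NormedAddCommGroup A'] [NormedSpace ℝ A'] (K : (A × (A →L[ℝ] ℝ)) ≃L[ℝ] A')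
    (c : GraphChart A (repOrbit ρ x)) {w : V} (hw : w ∈ repOrbit ρ x) (hwc : w ∈ c.dom) :
    ∃ (d : GraphChart A' (semidirectOrbit E ρ B x)) (τ : A' → A × (A →L[ℝ] ℝ)),
      ContDiffOn ℝ ∞ τ d.param ∧
      (∀ y ∈ d.param, (τ y).1 ∈ c.param ∧ d.sec y = fiberPoint E B c (τ y)) ∧
      ∀ α : E →L[ℝ] ℝ, dualPoint (E := E) ρ B w α ∈ d.dom := by
  obtain ⟨d, τ, hτ, hd, hα⟩ := exists_graphChart_prod_semidirectOrbit hρ hB hA c hw hwc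
  exact ⟨d.reparam K, fun y => τ (K.symm y),
    hτ.comp K.symm.contDiff.contDiffOn fun _ hy => hy, fun y hy => hd (K.symm y) hy, hα⟩

end FiberPoint

/-! ### The coadjoint orbit and the cotangent bundle -/

section CotangentEquiv

variable {E : Type*} [NormedAddCommGroup E] [NormedSpace ℝ E]
  {G : Type*} [Group G] [TopologicalSpace G] [ChartedSpace E G] [LieGroup 𝓘(ℝ, E) ∞ G]
  {V : Type*} [NormedAddCommGroup V] [NormedSpace ℝ V] [FiniteDimensional ℝ V]
  {ρ : G →* (V →L[ℝ] V)} {B : V →L[ℝ] V →L[ℝ] ℝ}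
  {A : Type*} [NormedAddCommGroup A] [NormedSpace ℝ A] [FiniteDimensional ℝ A] {x : V}
  [ChartedSpace A (repOrbit ρ x)] [IsManifold 𝓘(ℝ, A) ∞ (repOrbit ρ x)]

variable (E B) in
/-- The functional `(X, u) ↦ γ(ρ(X) w) + ⟨w, u⟩` attached to a covector `γ` at `w`. -/
def cotangentFunctional (c : repOrbit ρ x → GraphChart A (repOrbit ρ x))
    (γ : CotangentBundle 𝓘(ℝ, A) (repOrbit ρ x)) : E × V →L[ℝ] ℝ :=
  ((γ.snd : A →L[ℝ] ℝ).comp ((c γ.proj).proj.comp (infAct E ρ γ.proj.1))).comp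
    (ContinuousLinearMap.fst ℝ E V) + (B γ.proj.1).comp (ContinuousLinearMap.snd ℝ E V)

omit [LieGroup 𝓘(ℝ, E) ∞ G] [FiniteDimensional ℝ V] [FiniteDimensional ℝ A]
  [IsManifold 𝓘(ℝ, A) ∞ (repOrbit ρ x)] in
theorem cotangentFunctional_apply (c : repOrbit ρ x → GraphChart A (repOrbit ρ x))
    (γ : CotangentBundle 𝓘(ℝ, A) (repOrbit ρ x)) (q : A →L[ℝ] ℝ) (hq : γ.snd = q) (Z : E × V) :
    cotangentFunctional E B c γ Z =
      q ((c γ.proj).proj (infAct E ρ γ.proj.1 Z.1)) + B γ.proj.1 Z.2 := by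
  subst hq
  rfl

omit [LieGroup 𝓘(ℝ, E) ∞ G] [FiniteDimensional ℝ A]
  [IsManifold 𝓘(ℝ, A) ∞ (repOrbit ρ x)] in
theorem basePoint_cotangentFunctional (hB : IsInvariantInner ρ B)
    (c : repOrbit ρ x → GraphChart A (repOrbit ρ x))
    (γ : CotangentBundle 𝓘(ℝ, A) (repOrbit ρ x)) :
    hB.basePoint E (cotangentFunctional E B c γ) = γ.proj.1 :=
  hB.basePoint_eq fun u => by
    obtain ⟨q, hq⟩ : ∃ q : A →L[ℝ] ℝ, γ.snd = q := ⟨_, rfl⟩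
    rw [cotangentFunctional_apply c γ q hq, map_zero, map_zero, map_zero, zero_add]

variable (c : repOrbit ρ x → GraphChart A (repOrbit ρ x)) (hc : ∀ p, p.1 ∈ (c p).dom)
  (hchart : ∀ p, chartAt A p = (c p).toChart p)
  (hval : ContMDiff 𝓘(ℝ, A) 𝓘(ℝ, V) ∞ (Subtype.val : repOrbit ρ x → V))
  (hρ : ContMDiff 𝓘(ℝ, E) 𝓘(ℝ, V →L[ℝ] V) ∞ ρ) (hB : IsInvariantInner ρ B)
  (hA : Module.finrank ℝ (LinearMap.range (infAct E ρ x : E →ₗ[ℝ] V)) = Module.finrank ℝ A)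

-- `(c w).proj (ρ(X) w)` is the tangent vector whose inclusion in `V` is `ρ(X) w`, which justifies
-- the use of `proj` in `cotangentFunctional`.
include hc hchart hval hρ in
omit [FiniteDimensional ℝ V] [FiniteDimensional ℝ A] in
theorem tangentIncl_proj_infAct (w : repOrbit ρ x) (X : E) :
    tangentIncl (repOrbit ρ x) 𝓘(ℝ, A) w ((c w).proj (infAct E ρ w.1 X)) = infAct E ρ w.1 X := by
  have h1 := tangentIncl_eq c hchart hval w w (hc w) ((c w).proj (infAct E ρ w.1 X))
  have h2 := proj_tangentIncl c hchart hval w ((c w).proj (infAct E ρ w.1 X))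
  rw [h2] at h1
  exact h1.trans (DFunLike.congr_fun (infAct_eq_fderiv_sec hρ (c w) w.2 (hc w)) X).symm

-- `cotangentFunctional` uses at each point the chart centred there. Independence of the chart comes
-- from pairing the covector with the intrinsic tangent vector `ρ(X) w`.
include hc hchart hval hρ in
omit [FiniteDimensional ℝ V] [FiniteDimensional ℝ A] in
theorem fiberPoint_extChartAt (γ₀ γ : CotangentBundle 𝓘(ℝ, A) (repOrbit ρ x))
    (h : γ.proj.1 ∈ (c γ₀.proj).dom) :
    fiberPoint E B (c γ₀.proj) (extChartAt (cotangentModel 𝓘(ℝ, A)) γ₀ γ) =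
      cotangentFunctional E B c γ := by
  refine ContinuousLinearMap.ext fun Z => ?_
  have h1 : (extChartAt (cotangentModel 𝓘(ℝ, A)) γ₀ γ).1 = (c γ₀.proj).proj γ.proj.1 :=
    (congrArg Prod.fst (extChartAt_cotangent_apply γ₀ γ)).trans
      (extChartAt_graph_apply c hchart γ₀.proj γ.proj)
  have hs : γ.proj ∈ (chartAt A γ₀.proj).source := by
    rw [hchart]; exact h
  rw [cotangentFunctional_apply c γ γ.snd rfl, fiberPoint_apply, h1,
    (c γ₀.proj).sec_proj _ γ.proj.2 h]
  refine congrArg (fun r => r + B γ.proj.1 Z.2) ?_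
  refine Eq.trans ?_ (cotangent_snd_apply γ₀ γ hs _).symm
  refine congrArg (extChartAt (cotangentModel 𝓘(ℝ, A)) γ₀ γ).2 ?_
  refine Eq.trans ?_ (mfderiv_extChartAt_graph c hchart hval γ₀.proj γ.proj _).symm
  rw [tangentIncl_proj_infAct c hc hchart hval hρ]

include hc hchart hval hρ hB in
omit [FiniteDimensional ℝ A] in
theorem cotangentFunctional_mem (γ : CotangentBundle 𝓘(ℝ, A) (repOrbit ρ x)) :
    cotangentFunctional E B c γ ∈ semidirectOrbit E ρ B x := by
  rw [← fiberPoint_extChartAt c hc hchart hval hρ γ γ (hc γ.proj)]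
  refine fiberPoint_mem hρ hB _ ?_
  have h := mem_extChartAt_target (I := cotangentModel 𝓘(ℝ, A)) γ
  rw [extChartAt_cotangent_target, extChartAt_graph_target c hchart] at h
  exact h.1

include hc hchart hval hρ hB in
omit [FiniteDimensional ℝ V] [FiniteDimensional ℝ A] in
theorem cotangentFunctional_eq_dualPoint (γ : CotangentBundle 𝓘(ℝ, A) (repOrbit ρ x)) (v : V)
    (hv : ∀ a : TangentSpace 𝓘(ℝ, A) γ.proj,
      γ.snd a = B v (tangentIncl (repOrbit ρ x) 𝓘(ℝ, A) γ.proj a)) :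
    cotangentFunctional E B c γ =
      dualPoint (E := E) ρ B γ.proj.1 (momentMap ρ B γ.proj.1 v) := by
  refine ContinuousLinearMap.ext fun Z => ?_
  refine Eq.trans ?_ (dualPoint_apply (E := E) (ρ := ρ) B γ.proj.1 _ Z).symm
  rw [cotangentFunctional_apply c γ γ.snd rfl]
  refine congrArg (fun r => r + B γ.proj.1 Z.2) ?_
  refine Eq.trans ?_ (momentMap_apply hρ _ _ _).symm
  refine (hv _).trans ?_
  rw [tangentIncl_proj_infAct c hc hchart hval hρ, hB.symm]

-- The restriction to `V` recovers the base point, and the covector is recovered because the `ρ(X)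
-- w` span the tangent space.
include hc hρ hB hA in
omit [IsManifold 𝓘(ℝ, A) ∞ (repOrbit ρ x)] in
theorem cotangentFunctional_injective : Function.Injective (cotangentFunctional E B c) := by
  rintro ⟨w, p⟩ ⟨w', p'⟩ h
  obtain rfl : w = w' := by
    have h1 := congrArg (hB.basePoint E) h
    rw [basePoint_cotangentFunctional, basePoint_cotangentFunctional] at h1
    exact Subtype.ext h1
  obtain rfl : p = p' := by
    refine ContinuousLinearMap.ext fun a => ?_
    obtain ⟨X, hX⟩ := proj_infAct_surjective hρ hA (c w) w.2 (hc w) a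
    have h1 := DFunLike.congr_fun h (X, (0 : V))
    rw [cotangentFunctional_apply c _ p rfl, cotangentFunctional_apply c _ p' rfl] at h1
    have h2 := add_right_cancel h1
    have h3 : (c w).proj (infAct E ρ w.1 X) = a := hX
    dsimp only at h2
    rw [h3] at h2
    exact h2
  rfl

-- The point `w + μ_w(v)` comes from the restriction of `⟨v, ·⟩` to the tangent space at `w`.
include hc hchart hval hρ hB in
omit [FiniteDimensional ℝ V] [FiniteDimensional ℝ A] in
theorem exists_cotangentFunctional_eq {ξ : E × V →L[ℝ] ℝ} (hξ : ξ ∈ semidirectOrbit E ρ B x) :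
    ∃ γ, cotangentFunctional E B c γ = ξ := by
  obtain ⟨w, hw, v, rfl⟩ := (mem_semidirectOrbit_iff hρ hB x ξ).1 hξ
  let p : TangentSpace 𝓘(ℝ, A) (⟨w, hw⟩ : repOrbit ρ x) →L[ℝ] ℝ :=
    (B v).comp (tangentIncl (repOrbit ρ x) 𝓘(ℝ, A) ⟨w, hw⟩)
  exact ⟨⟨⟨w, hw⟩, p⟩, cotangentFunctional_eq_dualPoint c hc hchart hval hρ hB ⟨⟨w, hw⟩, p⟩ v
    fun a => rfl⟩

/-- The bijection from the coadjoint orbit to the cotangent bundle. -/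
def orbitEquiv : semidirectOrbit E ρ B x ≃ CotangentBundle 𝓘(ℝ, A) (repOrbit ρ x) :=
  (Equiv.ofBijective
    (fun γ => (⟨cotangentFunctional E B c γ, cotangentFunctional_mem c hc hchart hval hρ hB γ⟩ :
      semidirectOrbit E ρ B x))
    ⟨fun _ _ h => cotangentFunctional_injective c hc hρ hB hA (congrArg Subtype.val h),
      fun ξ => (exists_cotangentFunctional_eq c hc hchart hval hρ hB ξ.2).imp
        fun _ h => Subtype.ext h⟩).symm

theorem orbitEquiv_symm_val (γ : CotangentBundle 𝓘(ℝ, A) (repOrbit ρ x)) :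
    ((orbitEquiv c hc hchart hval hρ hB hA).symm γ).1 = cotangentFunctional E B c γ := rfl

theorem orbitEquiv_eq {ξ : semidirectOrbit E ρ B x}
    {γ : CotangentBundle 𝓘(ℝ, A) (repOrbit ρ x)} (h : cotangentFunctional E B c γ = ξ.1) :
    orbitEquiv c hc hchart hval hρ hB hA ξ = γ :=
  (Equiv.eq_symm_apply _).1 (Subtype.ext h.symm)

theorem cotangentFunctional_orbitEquiv (ξ : semidirectOrbit E ρ B x) :
    cotangentFunctional E B c (orbitEquiv c hc hchart hval hρ hB hA ξ) = ξ.1 := by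
  rw [← orbitEquiv_symm_val c hc hchart hval hρ hB hA, Equiv.symm_apply_apply]

theorem orbitEquiv_proj (ξ : semidirectOrbit E ρ B x) :
    (orbitEquiv c hc hchart hval hρ hB hA ξ).proj.1 = hB.basePoint E ξ.1 := by
  rw [← basePoint_cotangentFunctional (E := E) hB c, cotangentFunctional_orbitEquiv]

include hc hchart hval hρ hB hA in
/-- The covectors at `w` correspond linearly to `μ_w(V)`. -/
theorem exists_momentMap_range_equiv (w : repOrbit ρ x) :
    ∃ ℓ : LinearMap.range (momentMap (E := E) ρ B w.1) ≃ₗ[ℝ] (TangentSpace 𝓘(ℝ, A) w →L[ℝ] ℝ),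
      ∀ (v : V) (a : TangentSpace 𝓘(ℝ, A) w),
        ℓ ⟨momentMap ρ B w.1 v, v, rfl⟩ a = B v (tangentIncl (repOrbit ρ x) 𝓘(ℝ, A) w a) := by
  -- The inverse of `ℓ` is built first: a covector is extended to `V` through `proj`, represented by
  -- a vector, and mapped by `μ_w`. The choice of extension does not affect the result.
  let P : (A →L[ℝ] ℝ) →ₗ[ℝ] V :=
    (hB.toDual.symm : (V →L[ℝ] ℝ) →ₗ[ℝ] V) ∘ₗ
      ((ContinuousLinearMap.compL ℝ V A ℝ).flip (c w).proj : (A →L[ℝ] ℝ) →ₗ[ℝ] (V →L[ℝ] ℝ))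
  let N : (A →L[ℝ] ℝ) →ₗ[ℝ] LinearMap.range (momentMap (E := E) ρ B w.1) :=
    (momentMap (E := E) ρ B w.1).rangeRestrict ∘ₗ P
  have hN : ∀ p (X : E), (N p).1 X = p ((c w).proj (infAct E ρ w.1 X)) := by
    intro p X
    refine (momentMap_apply hρ w.1 (P p) X).trans ?_
    rw [hB.symm]
    exact DFunLike.congr_fun (hB.apply_toDual_symm (p.comp (c w).proj)) _
  have hv : ∀ v : V, N ((B v).comp (tangentIncl (repOrbit ρ x) 𝓘(ℝ, A) w)) =
      ⟨momentMap ρ B w.1 v, v, rfl⟩ := by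
    intro v
    refine Subtype.ext (ContinuousLinearMap.ext fun X => ?_)
    refine (hN _ X).trans (Eq.trans ?_ (momentMap_apply hρ w.1 v X).symm)
    refine (congrArg (B v) (tangentIncl_proj_infAct c hc hchart hval hρ w X)).trans ?_
    rw [hB.symm]
  have hinj : Function.Injective N := by
    intro p p' h
    refine ContinuousLinearMap.ext fun a => ?_
    obtain ⟨X, hX⟩ := proj_infAct_surjective hρ hA (c w) w.2 (hc w) a
    have h1 := (hN p X).symm.trans ((congrArg (fun α => α.1 X) h).trans (hN p' X))
    have h2 : (c w).proj (infAct E ρ w.1 X) = a := hX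
    rwa [h2] at h1
  have hsurj : Function.Surjective N := by
    rintro ⟨_, v, rfl⟩
    exact ⟨_, hv v⟩
  let ℓ := (LinearEquiv.ofBijective N ⟨hinj, hsurj⟩).symm
  refine ⟨ℓ, fun v a => ?_⟩
  have h : ℓ ⟨momentMap ρ B w.1 v, v, rfl⟩ =
      (B v).comp (tangentIncl (repOrbit ρ x) 𝓘(ℝ, A) w) :=
    (LinearEquiv.symm_apply_eq _).2 (hv v).symm
  exact DFunLike.congr_fun h a

end CotangentEquiv

/-! ### Smoothness of the bijection and comparison of the symplectic forms -/

section OrbitDiffeomorph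

variable {E : Type*} [NormedAddCommGroup E] [NormedSpace ℝ E]
  {G : Type*} [Group G] [TopologicalSpace G] [ChartedSpace E G] [LieGroup 𝓘(ℝ, E) ∞ G]
  {V : Type*} [NormedAddCommGroup V] [NormedSpace ℝ V] [FiniteDimensional ℝ V]
  {ρ : G →* (V →L[ℝ] V)} {B : V →L[ℝ] V →L[ℝ] ℝ}
  {A : Type*} [NormedAddCommGroup A] [NormedSpace ℝ A] [FiniteDimensional ℝ A] {x : V}
  [ChartedSpace A (repOrbit ρ x)] [IsManifold 𝓘(ℝ, A) ∞ (repOrbit ρ x)]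
  (c : repOrbit ρ x → GraphChart A (repOrbit ρ x)) (hc : ∀ p, p.1 ∈ (c p).dom)
  (hchart : ∀ p, chartAt A p = (c p).toChart p)
  (hval : ContMDiff 𝓘(ℝ, A) 𝓘(ℝ, V) ∞ (Subtype.val : repOrbit ρ x → V))
  (hρ : ContMDiff 𝓘(ℝ, E) 𝓘(ℝ, V →L[ℝ] V) ∞ ρ) (hB : IsInvariantInner ρ B)
  (hA : Module.finrank ℝ (LinearMap.range (infAct E ρ x : E →ₗ[ℝ] V)) = Module.finrank ℝ A)
  {A' : Type*} [NormedAddCommGroup A'] [NormedSpace ℝ A']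
  [ChartedSpace A' (semidirectOrbit E ρ B x)] [IsManifold 𝓘(ℝ, A') ∞ (semidirectOrbit E ρ B x)]
  (d : semidirectOrbit E ρ B x → GraphChart A' (semidirectOrbit E ρ B x))
  (hd : ∀ ξ, ξ.1 ∈ (d ξ).dom)
  (hdchart : ∀ ξ, chartAt A' ξ = (d ξ).toChart ξ)
  (hdval : ContMDiff 𝓘(ℝ, A') 𝓘(ℝ, E × V →L[ℝ] ℝ) ∞
    (Subtype.val : semidirectOrbit E ρ B x → E × V →L[ℝ] ℝ))
  (hτ : ∀ (ξ : semidirectOrbit E ρ B x) (w : repOrbit ρ x), hB.basePoint E ξ.1 = w.1 →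
    ∃ τ : A' → A × (A →L[ℝ] ℝ), ContDiffOn ℝ ∞ τ (d ξ).param ∧
      ∀ y ∈ (d ξ).param, (τ y).1 ∈ (c w).param ∧ (d ξ).sec y = fiberPoint E B (c w) (τ y))

include hc hchart hval hρ in
omit [FiniteDimensional ℝ V] [FiniteDimensional ℝ A] in
theorem cotangentFunctional_eventuallyEq (γ : CotangentBundle 𝓘(ℝ, A) (repOrbit ρ x)) :
    cotangentFunctional E B c =ᶠ[𝓝 γ]
      fiberPoint E B (c γ.proj) ∘ extChartAt (cotangentModel 𝓘(ℝ, A)) γ := by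
  refine Filter.eventuallyEq_of_mem (extChartAt_source_mem_nhds (I := cotangentModel 𝓘(ℝ, A)) γ)
    fun γ' hγ' => ?_
  rw [mem_extChartAt_cotangent_source, hchart] at hγ'
  exact (fiberPoint_extChartAt c hc hchart hval hρ γ γ' hγ').symm

include hchart in
omit [LieGroup 𝓘(ℝ, E) ∞ G] [FiniteDimensional ℝ V] [FiniteDimensional ℝ A]
  [TopologicalSpace G] [ChartedSpace E G] in
theorem extChartAt_cotangent_self_mem (γ : CotangentBundle 𝓘(ℝ, A) (repOrbit ρ x)) :
    (extChartAt (cotangentModel 𝓘(ℝ, A)) γ γ).1 ∈ (c γ.proj).param := by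
  have h := mem_extChartAt_target (I := cotangentModel 𝓘(ℝ, A)) γ
  rw [extChartAt_cotangent_target, extChartAt_graph_target c hchart] at h
  exact h.1

include hc hchart hval hρ in
omit [FiniteDimensional ℝ V] [FiniteDimensional ℝ A] in
theorem contMDiff_cotangentFunctional :
    ContMDiff (cotangentModel 𝓘(ℝ, A)) 𝓘(ℝ, E × V →L[ℝ] ℝ) ∞
      (cotangentFunctional E B c : CotangentBundle 𝓘(ℝ, A) (repOrbit ρ x) → _) := by
  intro γ
  have h1 : ContMDiffAt 𝓘(ℝ, A × (A →L[ℝ] ℝ)) 𝓘(ℝ, E × V →L[ℝ] ℝ) ∞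
      (fiberPoint E B (c γ.proj)) (extChartAt (cotangentModel 𝓘(ℝ, A)) γ γ) :=
    ((contDiffOn_fiberPoint (E := E) (B := B) (c γ.proj)).contDiffAt
      (((c γ.proj).isOpen_param.prod isOpen_univ).mem_nhds
        ⟨extChartAt_cotangent_self_mem c hchart γ, trivial⟩)).contMDiffAt
  have h2 : ContMDiffAt (cotangentModel 𝓘(ℝ, A)) 𝓘(ℝ, A × (A →L[ℝ] ℝ)) ∞
      (extChartAt (cotangentModel 𝓘(ℝ, A)) γ) γ := contMDiffAt_extChartAt
  exact (h1.comp γ h2).congr_of_eventuallyEq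
    (cotangentFunctional_eventuallyEq c hc hchart hval hρ γ)

-- Charts of the coadjoint orbit are restrictions of linear maps, so smoothness into the orbit
-- follows from smoothness into the ambient dual.
include hdchart in
omit [IsManifold 𝓘(ℝ, A') ∞ (semidirectOrbit E ρ B x)] in
theorem contMDiff_orbitEquiv_symm :
    ContMDiff (cotangentModel 𝓘(ℝ, A)) 𝓘(ℝ, A') ∞
      (orbitEquiv c hc hchart hval hρ hB hA).symm := by
  have h := contMDiff_cotangentFunctional (B := B) c hc hchart hval hρ
  intro γ
  rw [contMDiffAt_iff_target]
  refine ⟨(Continuous.subtype_mk h.continuous fun γ =>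
    cotangentFunctional_mem c hc hchart hval hρ hB γ).continuousAt, ?_⟩
  have h1 := ((d ((orbitEquiv c hc hchart hval hρ hB hA).symm γ)).proj.contMDiff (n := ∞)).comp h γ
  refine h1.congr_of_eventuallyEq (Filter.Eventually.of_forall fun γ' => ?_)
  exact extChartAt_graph_apply d hdchart _ _

-- Near `ξ₀` the map is the linear projection of the graph chart, followed by `τ` and the inverse
-- cotangent chart; the hypothesis `hτ` says that `τ` converts graph parameters to cotangent
-- coordinates.
include hd hdval hτ in
omit [IsManifold 𝓘(ℝ, A') ∞ (semidirectOrbit E ρ B x)] in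
theorem contMDiff_orbitEquiv :
    ContMDiff 𝓘(ℝ, A') (cotangentModel 𝓘(ℝ, A)) ∞ (orbitEquiv c hc hchart hval hρ hB hA) := by
  intro ξ₀
  set γ₀ := orbitEquiv c hc hchart hval hρ hB hA ξ₀ with hγ₀
  obtain ⟨τ, hτs, hτ'⟩ := hτ ξ₀ γ₀.proj (orbitEquiv_proj c hc hchart hval hρ hB hA ξ₀).symm
  set e := extChartAt (cotangentModel 𝓘(ℝ, A)) γ₀ with he
  have htarget : ∀ y ∈ (d ξ₀).param, τ y ∈ e.target := by
    intro y hy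
    rw [he, extChartAt_cotangent_target, extChartAt_graph_target c hchart]
    exact ⟨(hτ' y hy).1, trivial⟩
  have hp₀ := (d ξ₀).proj_mem _ ξ₀.2 (hd ξ₀)
  have h1 : ContMDiffAt 𝓘(ℝ, A') 𝓘(ℝ, A') ∞ (fun ξ => (d ξ₀).proj ξ.1) ξ₀ :=
    ((d ξ₀).proj.contMDiff (n := ∞)).comp hdval ξ₀
  have h2 : ContMDiffAt 𝓘(ℝ, A') 𝓘(ℝ, A × (A →L[ℝ] ℝ)) ∞ τ ((d ξ₀).proj ξ₀.1) :=
    (hτs.contDiffAt ((d ξ₀).isOpen_param.mem_nhds hp₀)).contMDiffAt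
  have h3 : ContMDiffAt 𝓘(ℝ, A × (A →L[ℝ] ℝ)) (cotangentModel 𝓘(ℝ, A)) ∞ e.symm
      (τ ((d ξ₀).proj ξ₀.1)) :=
    (contMDiffOn_extChartAt_symm γ₀).contMDiffAt
      ((isOpen_extChartAt_target γ₀).mem_nhds (htarget _ hp₀))
  refine (h3.comp ξ₀ (h2.comp ξ₀ h1)).congr_of_eventuallyEq ?_
  refine Filter.eventuallyEq_of_mem
    (((d ξ₀).isOpen_dom.preimage continuous_subtype_val).mem_nhds (hd ξ₀)) fun ξ hξ => ?_
  have hp := (d ξ₀).proj_mem _ ξ.2 hξ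
  have ht := htarget _ hp
  refine orbitEquiv_eq c hc hchart hval hρ hB hA ?_
  change cotangentFunctional E B c (e.symm (τ ((d ξ₀).proj ξ.1))) = ξ.1
  have hs : (e.symm (τ ((d ξ₀).proj ξ.1))).proj.1 ∈ (c γ₀.proj).dom := by
    have h := e.map_target ht
    rw [he, mem_extChartAt_cotangent_source, hchart] at h
    exact h
  rw [← fiberPoint_extChartAt c hc hchart hval hρ γ₀ _ hs, ← he, e.right_inv ht,
    ← (hτ' _ hp).2, (d ξ₀).sec_proj _ ξ.2 hξ]

/-- The diffeomorphism from the coadjoint orbit to the cotangent bundle. -/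
def orbitDiffeomorph : Diffeomorph 𝓘(ℝ, A') (cotangentModel 𝓘(ℝ, A)) (semidirectOrbit E ρ B x)
    (CotangentBundle 𝓘(ℝ, A) (repOrbit ρ x)) ∞ where
  toEquiv := orbitEquiv c hc hchart hval hρ hB hA
  contMDiff_toFun := contMDiff_orbitEquiv c hc hchart hval hρ hB hA d hd hdval hτ
  contMDiff_invFun := contMDiff_orbitEquiv_symm c hc hchart hval hρ hB hA d hdchart

omit [FiniteDimensional ℝ A] [IsManifold 𝓘(ℝ, A') ∞ (semidirectOrbit E ρ B x)]
  [FiniteDimensional ℝ V] in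
include hc hchart hval hρ in
/-- Tangent vectors of the coadjoint orbit in cotangent coordinates. -/
theorem tangentIncl_eq_fderiv_fiberPoint
    (φ : Diffeomorph 𝓘(ℝ, A') (cotangentModel 𝓘(ℝ, A)) (semidirectOrbit E ρ B x)
      (CotangentBundle 𝓘(ℝ, A) (repOrbit ρ x)) ∞)
    (hφ : ∀ ξ, cotangentFunctional E B c (φ ξ) = ξ.1) (ξ : semidirectOrbit E ρ B x)
    (a : TangentSpace 𝓘(ℝ, A') ξ) :
    tangentIncl (semidirectOrbit E ρ B x) 𝓘(ℝ, A') ξ a =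
      fderiv ℝ (fiberPoint E B (c (φ ξ).proj)) (extChartAt (cotangentModel 𝓘(ℝ, A)) (φ ξ) (φ ξ))
        (mfderiv (cotangentModel 𝓘(ℝ, A)) 𝓘(ℝ, A × (A →L[ℝ] ℝ))
          (extChartAt (cotangentModel 𝓘(ℝ, A)) (φ ξ)) (φ ξ)
          (mfderiv 𝓘(ℝ, A') (cotangentModel 𝓘(ℝ, A)) φ ξ a)) := by
  have h1 := ((φ.contMDiff ξ).mdifferentiableAt (by simp)).hasMFDerivAt
  have h2 : HasMFDerivAt (cotangentModel 𝓘(ℝ, A)) 𝓘(ℝ, A × (A →L[ℝ] ℝ))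
      (extChartAt (cotangentModel 𝓘(ℝ, A)) (φ ξ)) (φ ξ) _ :=
    (mdifferentiableAt_extChartAt (I := cotangentModel 𝓘(ℝ, A))
      (mem_chart_source _ (φ ξ))).hasMFDerivAt
  have h3 := (hasFDerivAt_fiberPoint (E := E) (B := B) (c (φ ξ).proj)
    (extChartAt_cotangent_self_mem c hchart (φ ξ))).hasMFDerivAt
  -- The inclusion factors through `φ` and cotangent coordinates, so the chain rule gives the claim.
  have h4 : (Subtype.val : semidirectOrbit E ρ B x → E × V →L[ℝ] ℝ) =ᶠ[𝓝 ξ]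
      fiberPoint E B (c (φ ξ).proj) ∘ extChartAt (cotangentModel 𝓘(ℝ, A)) (φ ξ) ∘ φ := by
    have h5 := φ.continuous.continuousAt.eventually
      (cotangentFunctional_eventuallyEq (B := B) c hc hchart hval hρ (φ ξ))
    filter_upwards [h5] with ξ' hξ'
    exact (hφ ξ').symm.trans hξ'
  have h6 := ((h3.comp ξ (h2.comp ξ h1)).congr_of_eventuallyEq h4).mfderiv
  exact DFunLike.congr_fun h6 a

variable [FiniteDimensional ℝ E]

include hc hchart hval hρ hB hA in
omit [IsManifold 𝓘(ℝ, A') ∞ (semidirectOrbit E ρ B x)] in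
/-- The canonical symplectic form pulls back to the Kostant–Kirillov–Souriau form. -/
theorem canonicalForm_eq_kksForm
    (φ : Diffeomorph 𝓘(ℝ, A') (cotangentModel 𝓘(ℝ, A)) (semidirectOrbit E ρ B x)
      (CotangentBundle 𝓘(ℝ, A) (repOrbit ρ x)) ∞)
    (hφ : ∀ ξ, cotangentFunctional E B c (φ ξ) = ξ.1) (ξ : semidirectOrbit E ρ B x)
    (a b : TangentSpace 𝓘(ℝ, A') ξ) :
    canonicalForm 𝓘(ℝ, A) (repOrbit ρ x) (φ ξ)
        (mfderiv 𝓘(ℝ, A') (cotangentModel 𝓘(ℝ, A)) φ ξ a)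
        (mfderiv 𝓘(ℝ, A') (cotangentModel 𝓘(ℝ, A)) φ ξ b) =
      kksForm (semidirectModel E V) (SemidirectGroup ρ) (semidirectOrbit E ρ B x) 𝓘(ℝ, A') ξ a b := by
  have hmem := extChartAt_cotangent_self_mem c hchart (φ ξ)
  have hξ : fiberPoint E B (c (φ ξ).proj)
      (extChartAt (cotangentModel 𝓘(ℝ, A)) (φ ξ) (φ ξ)) = ξ.1 :=
    (fiberPoint_extChartAt c hc hchart hval hρ (φ ξ) (φ ξ) (hc _)).trans (hφ ξ)
  have ha := tangentIncl_eq_fderiv_fiberPoint c hc hchart hval hρ φ hφ ξ a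
  have hb := tangentIncl_eq_fderiv_fiberPoint c hc hchart hval hρ φ hφ ξ b
  -- Naming the coordinate vectors as elements of `A × A*` removes the dependent tangent-space
  -- types.
  obtain ⟨a', ha'⟩ : ∃ a' : A × (A →L[ℝ] ℝ),
      mfderiv (cotangentModel 𝓘(ℝ, A)) 𝓘(ℝ, A × (A →L[ℝ] ℝ))
          (extChartAt (cotangentModel 𝓘(ℝ, A)) (φ ξ)) (φ ξ)
          (mfderiv 𝓘(ℝ, A') (cotangentModel 𝓘(ℝ, A)) φ ξ a) = a' := ⟨_, rfl⟩
  obtain ⟨b', hb'⟩ : ∃ b' : A × (A →L[ℝ] ℝ),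
      mfderiv (cotangentModel 𝓘(ℝ, A)) 𝓘(ℝ, A × (A →L[ℝ] ℝ))
          (extChartAt (cotangentModel 𝓘(ℝ, A)) (φ ξ)) (φ ξ)
          (mfderiv 𝓘(ℝ, A') (cotangentModel 𝓘(ℝ, A)) φ ξ b) = b' := ⟨_, rfl⟩
  rw [ha'] at ha
  rw [hb'] at hb
  obtain ⟨X, Y, hX, hY, hXY⟩ := fiberPoint_bracket hρ hB hA (c (φ ξ).proj) hmem a' b'
  rw [hξ, ← ha] at hX
  rw [hξ, ← hb] at hY
  rw [hξ] at hXY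
  rw [canonicalForm_eq (φ ξ) _ _ a' b' ha' hb',
    kksForm_eq (semidirectModel E V) (SemidirectGroup ρ) (semidirectOrbit E ρ B x) 𝓘(ℝ, A')
      ξ a b X Y hX hY]
  exact hXY.symm

end OrbitDiffeomorph

end SemidirectOrbit

end

/-! ### The main theorem -/

open SemidirectOrbit in
theorem mainTheorem5
    {E : Type*} [NormedAddCommGroup E] [NormedSpace ℝ E] [FiniteDimensional ℝ E]
    {G : Type*} [Group G] [TopologicalSpace G] [ChartedSpace E G] [LieGroup 𝓘(ℝ, E) ∞ G]
    [CompactSpace G]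
    {V : Type*} [NormedAddCommGroup V] [NormedSpace ℝ V] [FiniteDimensional ℝ V]
    (ρ : G →* (V →L[ℝ] V)) (hρ : ContMDiff 𝓘(ℝ, E) 𝓘(ℝ, V →L[ℝ] V) ∞ ρ) :
    (∃ B : V →L[ℝ] V →L[ℝ] ℝ, IsInvariantInner ρ B) ∧
    ∀ B : V →L[ℝ] V →L[ℝ] ℝ, IsInvariantInner ρ B → ∀ x : V,
      -- both orbits are embedded submanifolds
      ∃ (m k : ℕ)
        (_ : ChartedSpace (EuclideanSpace ℝ (Fin m)) (repOrbit ρ x))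
        (_ : IsManifold (𝓡 m) ∞ (repOrbit ρ x))
        (_ : Manifold.IsSmoothEmbedding (𝓡 m) 𝓘(ℝ, V) ∞ (Subtype.val : repOrbit ρ x → V))
        (_ : ChartedSpace (EuclideanSpace ℝ (Fin k)) (semidirectOrbit E ρ B x))
        (_ : IsManifold (𝓡 k) ∞ (semidirectOrbit E ρ B x))
        (_ : Manifold.IsSmoothEmbedding (𝓡 k)
          𝓘(ℝ, DualLieAlgebra (semidirectModel E V) (SemidirectGroup ρ)) ∞
          (Subtype.val : semidirectOrbit E ρ B x → _))
        -- a diffeomorphism onto the cotangent bundle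
        (φ : Diffeomorph (𝓡 k) (cotangentModel (𝓡 m)) (semidirectOrbit E ρ B x)
          (CotangentBundle (𝓡 m) (repOrbit ρ x)) ∞)
        (ℓ : ∀ w : repOrbit ρ x, LinearMap.range (momentMap (E := E) ρ B w.1) ≃ₗ[ℝ]
          (TangentSpace (𝓡 m) w →L[ℝ] ℝ)),
        -- it maps the fibre `w + μ_w(V)` onto `T_w^*`
        (∀ w : repOrbit ρ x, orbitFiber (E := E) ρ B w.1 ⊆ semidirectOrbit E ρ B x ∧
          φ '' (Subtype.val ⁻¹' orbitFiber ρ B w.1) = {γ | γ.proj = w}) ∧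
        -- on that fibre it is the linear isomorphism `ℓ w`
        (∀ (w : repOrbit ρ x) (ξ : semidirectOrbit E ρ B x)
          (α : LinearMap.range (momentMap (E := E) ρ B w.1)),
          ξ.1 = dualPoint ρ B w.1 α.1 → φ ξ = ⟨w, ℓ w α⟩) ∧
        -- which sends `μ_w(v)` to the restriction of `⟨v, ·⟩` to the tangent space
        (∀ (w : repOrbit ρ x) (v : V) (a : TangentSpace (𝓡 m) w),
          ℓ w ⟨momentMap ρ B w.1 v, v, rfl⟩ a = B v (tangentIncl (repOrbit ρ x) (𝓡 m) w a)) ∧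
        -- `φ^* ω = Ω`
        (∀ (ξ : semidirectOrbit E ρ B x) (a b : TangentSpace (𝓡 k) ξ),
          canonicalForm (𝓡 m) (repOrbit ρ x) (φ ξ)
            (mfderiv (𝓡 k) (cotangentModel (𝓡 m)) φ ξ a)
            (mfderiv (𝓡 k) (cotangentModel (𝓡 m)) φ ξ b) =
          kksForm (semidirectModel E V) (SemidirectGroup ρ) (semidirectOrbit E ρ B x) (𝓡 k) ξ a b) := by
  have : IsTopologicalGroup G := topologicalGroup_of_lieGroup 𝓘(ℝ, E) ∞
  refine ⟨exists_isInvariantInner ρ hρ.continuous, fun B hB x => ?_⟩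
  -- The dimension of the orbit of `x` is the rank of `X ↦ ρ(X) x`.
  let m := Module.finrank ℝ (LinearMap.range (infAct E ρ x : E →ₗ[ℝ] V))
  let A := EuclideanSpace ℝ (Fin m)
  have hA : Module.finrank ℝ (LinearMap.range (infAct E ρ x : E →ₗ[ℝ] V)) =
      Module.finrank ℝ A := by simp [A, m]
  let k := Module.finrank ℝ (A × (A →L[ℝ] ℝ))
  let K : (A × (A →L[ℝ] ℝ)) ≃L[ℝ] EuclideanSpace ℝ (Fin k) :=
    ContinuousLinearEquiv.ofFinrankEq (by simp [k])
  choose c hc using exists_graphChart_repOrbit (A := A) hρ x hA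
  have hbase : ∀ ξ : semidirectOrbit E ρ B x, ∃ w : repOrbit ρ x,
      hB.basePoint E ξ.1 = w.1 ∧ ∃ α : E →L[ℝ] ℝ, ξ.1 = dualPoint (E := E) ρ B w.1 α := by
    intro ξ
    obtain ⟨w, hw, v, hv⟩ := (mem_semidirectOrbit_iff hρ hB x ξ.1).1 ξ.2
    exact ⟨⟨w, hw⟩, (congrArg (hB.basePoint E) hv).trans (basePoint_dualPoint hB w _), _, hv⟩
  choose w hw hdual using hbase
  choose d τ hτs hτ hdom using fun ξ : semidirectOrbit E ρ B x =>
    exists_graphChart_semidirectOrbit hρ hB hA K (c (w ξ)) (w ξ).2 (hc (w ξ))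
  have hd : ∀ ξ, ξ.1 ∈ (d ξ).dom := by
    intro ξ
    obtain ⟨α, hα⟩ := hdual ξ
    rw [hα]
    exact hdom ξ α
  have hτ₀ : ∀ (ξ : semidirectOrbit E ρ B x) (w : repOrbit ρ x), hB.basePoint E ξ.1 = w.1 →
      ∃ τ : EuclideanSpace ℝ (Fin k) → A × (A →L[ℝ] ℝ), ContDiffOn ℝ ∞ τ (d ξ).param ∧
        ∀ y ∈ (d ξ).param, (τ y).1 ∈ (c w).param ∧ (d ξ).sec y = fiberPoint E B (c w) (τ y) := by
    intro ξ w₁ hw₁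
    -- The base point of `ξ` is unique, so the chosen `w ξ` is the only case.
    obtain rfl : w ξ = w₁ := Subtype.ext ((hw ξ).symm.trans hw₁)
    exact ⟨τ ξ, hτs ξ, hτ ξ⟩
  let _ : ChartedSpace A (repOrbit ρ x) := graphChartedSpace c hc
  have hM : IsManifold 𝓘(ℝ, A) ∞ (repOrbit ρ x) := isManifold_graphChartedSpace c hc
  have hMe : Manifold.IsSmoothEmbedding 𝓘(ℝ, A) 𝓘(ℝ, V) ∞ (Subtype.val : repOrbit ρ x → V) :=
    isSmoothEmbedding_graphChartedSpace c hc
  have hchart : ∀ p : repOrbit ρ x, chartAt A p = (c p).toChart p := fun _ => rfl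
  let _ : ChartedSpace (EuclideanSpace ℝ (Fin k)) (semidirectOrbit E ρ B x) :=
    graphChartedSpace d hd
  have hO : IsManifold (𝓡 k) ∞ (semidirectOrbit E ρ B x) := isManifold_graphChartedSpace d hd
  have hOe : Manifold.IsSmoothEmbedding (𝓡 k)
      𝓘(ℝ, DualLieAlgebra (semidirectModel E V) (SemidirectGroup ρ)) ∞
      (Subtype.val : semidirectOrbit E ρ B x → _) :=
    isSmoothEmbedding_graphChartedSpace d hd
  have hdchart : ∀ ξ : semidirectOrbit E ρ B x,
      chartAt (EuclideanSpace ℝ (Fin k)) ξ = (d ξ).toChart ξ := fun _ => rfl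
  let φ := orbitDiffeomorph c hc hchart hMe.contMDiff hρ hB hA d hd hdchart hOe.contMDiff hτ₀
  have hφ : ∀ ξ, cotangentFunctional E B c (φ ξ) = ξ.1 :=
    cotangentFunctional_orbitEquiv c hc hchart hMe.contMDiff hρ hB hA
  choose ℓ hℓ using exists_momentMap_range_equiv c hc hchart hMe.contMDiff hρ hB hA
  have hφℓ : ∀ (w : repOrbit ρ x) (ξ : semidirectOrbit E ρ B x)
      (α : LinearMap.range (momentMap (E := E) ρ B w.1)),
      ξ.1 = dualPoint ρ B w.1 α.1 → φ ξ = ⟨w, ℓ w α⟩ := by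
    rintro w ξ ⟨_, v, rfl⟩ h
    refine orbitEquiv_eq c hc hchart hMe.contMDiff hρ hB hA ?_
    exact (cotangentFunctional_eq_dualPoint c hc hchart hMe.contMDiff hρ hB
      ⟨w, ℓ w ⟨momentMap ρ B w.1 v, v, rfl⟩⟩ v (hℓ w v)).trans h.symm
  have hsub : ∀ w : repOrbit ρ x, orbitFiber (E := E) ρ B w.1 ⊆ semidirectOrbit E ρ B x := by
    rintro w _ ⟨_, ⟨v, rfl⟩, rfl⟩
    exact (mem_semidirectOrbit_iff hρ hB x _).2 ⟨w.1, w.2, v, rfl⟩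
  refine ⟨m, k, inferInstance, hM, hMe, inferInstance, hO, hOe, φ, ℓ, fun w => ⟨hsub w, ?_⟩, hφℓ, hℓ,
    fun ξ a b => canonicalForm_eq_kksForm c hc hchart hMe.contMDiff hρ hB hA φ hφ ξ a b⟩
  refine Set.Subset.antisymm ?_ ?_
  · rintro _ ⟨ξ, ⟨α, hα, hξ⟩, rfl⟩
    exact congrArg (fun γ => γ.proj) (hφℓ w ξ ⟨α, hα⟩ hξ.symm)
  · rintro ⟨w, p⟩ rfl
    obtain ⟨α, hα⟩ := (ℓ w).surjective p
    let ξ : semidirectOrbit E ρ B x :=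
      ⟨dualPoint ρ B w.1 α.1, hsub w ⟨α.1, α.2, rfl⟩⟩
    refine ⟨ξ, ⟨α.1, α.2, rfl⟩, ?_⟩
    rw [← hα]
    exact hφℓ w ξ α rfl
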